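/- \textbf{Setting.} Let $p$ be fixed, $\Theta\subset\mathbb R^p$, $\theta_0\in\Theta$ with $\theta_{0j}\ne 0$ for $j\le d_0$ and $\theta_{0j}=0$ for $j>d_0$, where $0<d_0<p$. Let $\mathcal L(\theta;z)$ be a loss that is twice differentiable in $\theta$ on the interior of $\Theta$. For each $N$ there are $N$ observations $Z_1,\dots,Z_N$, distributed over $K=K_N$ workers; $\mathcal S_k$ is the set of the $n_k=|\mathcal S_k|$ observations on worker $k$, $n=N/K$, and $c_1\le n_k/n\le c_2$ for all $k\le K$ with constants $c_1,c_2>0$. Assume $n/\sqrt N\to\infty$ as $N\to\infty$ (automatic if $K$ is bounded). Put $\mathcal L_k(\theta)=n_k^{-1}\sum_{i\in\mathcal S_k}\mathcal L(\theta;Z_i)$ and $\widehat\theta_k\in\arg\min_{\theta\in\Theta}\mathcal L_k(\theta)$. Write $E_k$ for the expectation when $Z$ is distributed as the observations on worker $k$. Assume: (C1) $\Theta$ is compact and convex and $\theta_0$ is an interior point of $\Theta$. (C2) All observations are independent, and those on worker $k$ are identically distributed, with a law that depends only on $k$. (C3) For every $\delta>0$ there is $\epsilon>0$ with $P\{\inf_{\theta\in\Theta,\,\|\theta-\theta_0\|\ge\delta,\,1\le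 k\le K}(\mathcal L_k(\theta)-\mathcal L_k(\theta_0))\ge\epsilon\}\to1$; and $E_k\{\partial_\theta\mathcal L(\theta_0;Z)\}=0$ for every $k$. (C4) For every $k$, $\Omega_k:=E_k\{\partial_\theta\mathcal L(\theta_0;Z)\,\partial_{\theta}\mathcal L(\theta_0;Z)^\top\}=E_k\{\partial^2_{\theta\theta^\top}\mathcal L(\theta_0;Z)\}$ exists and is nonsingular. (C5) There are $\delta>0$ and functions $M_{ijl}$ such that for almost every $z$ all third partial derivatives of $\mathcal L(\cdot;z)$ exist on $\{\theta\in\Theta:\|\theta-\theta_0\|\le\delta\}$ and are bounded there by $M_{ijl}(z)$ in absolute value, with $E_k\{M_{ijl}(Z)\}<\infty$ for every $k$. If $K_N$ is not bounded, assume in addition that these conditions are uniform in $k$, in the sense that the smallest eigenvalue of $\Omega_k$ is bounded away from $0$ and the second moments $E_k\{(\partial^2_{\theta_i\theta_j}\mathcal L(\theta_0;Z))^2\}$ and $E_k\{M_{ijl}(Z)^2\}$ are bounded, by constants that do not depend on $k$. Let $\lambda_1,\dots,\lambda_p\ge0$ be (possibly random) tuning parameters depending on $N$, and let $\widetilde\theta_\lambda$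 minimize over $\mathbb R^p$ $$Q_\lambda(\theta)=\frac1N\sum_{k=1}^K(\theta-\widehat\theta_k)^\top\Big\{\sum_{i\in\mathcal S_k}\partial^2_{\theta\theta^\top}\mathcal L(\widehat\theta_k;Z_i)\Big\}(\theta-\widehat\theta_k)+\sum_{j=1}^p\lambda_j|\theta_j|$$ (whenever a minimizer exists; otherwise $\widetilde\theta_\lambda$ is arbitrary). Put $a_\lambda=\max_{j\le d_0}\lambda_j$ and $b_\lambda=\min_{j>d_0}\lambda_j$. \textbf{Theorem (consistency).} (a) If $\sqrt N a_\lambda\to0$ in probability, then $\widetilde\theta_\lambda-\theta_0=O_p(N^{-1/2})$. (b) If $\sqrt N a_\lambda\to0$ and $\sqrt N b_\lambda\to\infty$ in probability, then $P(\widetilde\theta_{\lambda,j}=0\text{ for all }j>d_0)\to1$. -/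

import Mathlib

open MeasureTheory ProbabilityTheory Filter Topology

noncomputable section

namespace DLSA

/-- Parameter vectors, with the Euclidean norm. -/
abbrev Par (p : ℕ) := EuclideanSpace ℝ (Fin p)

/-! ### Derivatives in the parameter -/

/-- The partial derivative `∂f/∂θ_i`. -/
def pderiv {p : ℕ} (i : Fin p) (f : Par p → ℝ) : Par p → ℝ :=
  fun θ => lineDeriv ℝ f θ (EuclideanSpace.single i 1)

/-- The partial derivative `∂f/∂θ_i` exists at `θ`. -/
def HasPartial {p : ℕ} (i : Fin p) (f : Par p → ℝ) (θ : Par p) : Prop :=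
  LineDifferentiableAt ℝ f θ (EuclideanSpace.single i 1)

/-- The Hessian matrix of `f` at `θ`. -/
def hess {p : ℕ} (f : Par p → ℝ) (θ : Par p) : Matrix (Fin p) (Fin p) ℝ :=
  Matrix.of fun i j => pderiv i (pderiv j f) θ

/-- `f` is twice (Fréchet) differentiable at every point of the open set `U`. -/
def TwiceDifferentiableOn {p : ℕ} (f : Par p → ℝ) (U : Set (Par p)) : Prop :=
  ∀ θ ∈ U, DifferentiableAt ℝ f θ ∧ DifferentiableAt ℝ (fderiv ℝ f) θ

/-- The quadratic form `vᵀ A v`. -/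
def quadForm {p : ℕ} (A : Matrix (Fin p) (Fin p) ℝ) (v : Par p) : ℝ :=
  ∑ i, ∑ j, v i * A i j * v j

/-! ### Stochastic orders

Sets of bad outcomes are measured by the (outer) measure `P`, so that no measurability has to be
assumed; for measurable events these are the usual notions. -/

/-- `P (A N) → 1`, written as `P (A N)ᶜ → 0`. -/
def ProbTendstoOne {Ω : Type*} [MeasurableSpace Ω] (P : Measure Ω) (A : ℕ → Set Ω) : Prop :=
  Tendsto (fun N => P (A N)ᶜ) atTop (𝓝 0)

/-- `X_N → ∞` in probability. -/
def TendstoInProbAtTop {Ω : Type*} [MeasurableSpace Ω] (P : Measure Ω) (X : ℕ → Ω → ℝ) : Prop :=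
  ∀ C : ℝ, ProbTendstoOne P fun N => {ω | C < X N ω}

/-- `X_N = O_p(r_N)`. -/
def IsBigOInProb {Ω E : Type*} [MeasurableSpace Ω] [Norm E] (P : Measure Ω)
    (X : ℕ → Ω → E) (r : ℕ → ℝ) : Prop :=
  ∀ ε : ENNReal, 0 < ε → ∃ C : ℝ, ∀ᶠ N in atTop, P {ω | C * r N < ‖X N ω‖} ≤ ε

/-! ### The distributed system

Stage `N` has the observations `0, …, N - 1` and the workers `0, …, K N - 1`;
observation `i` is stored on worker `w N i`. -/

/-- The observations `𝒮_k` stored on worker `k` at stage `N`. -/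
def shard (w : ℕ → ℕ → ℕ) (N k : ℕ) : Finset ℕ := (Finset.range N).filter fun i => w N i = k

/-- Every observation sits on one of the `K N` workers, and the worker sizes are all of the order
of the average `n = N / K`. -/
structure IsBalancedDesign (K : ℕ → ℕ) (w : ℕ → ℕ → ℕ) : Prop where
  worker_lt : ∀ N, ∀ i < N, w N i < K N
  balanced : ∃ c₁ c₂ : ℝ, 0 < c₁ ∧ 0 < c₂ ∧ ∀ N, ∀ k < K N,
    c₁ * ((N : ℝ) / K N) ≤ ((shard w N k).card : ℝ) ∧
      ((shard w N k).card : ℝ) ≤ c₂ * ((N : ℝ) / K N)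

/-- (C2) At every stage the observations are independent, and those on worker `k` have the common
law `μ k`. -/
structure IsSample {Ω 𝒵 : Type*} [MeasurableSpace Ω] [MeasurableSpace 𝒵] (P : Measure Ω)
    (μ : ℕ → Measure 𝒵) (w : ℕ → ℕ → ℕ) (Z : ℕ → ℕ → Ω → 𝒵) : Prop where
  measurable : ∀ N, ∀ i < N, Measurable (Z N i)
  indep : ∀ N, iIndepFun (fun i : Fin N => Z N i) P
  law : ∀ N, ∀ i < N, P.map (Z N i) = μ (w N i)

section Estimators

variable {p : ℕ} {Ω 𝒵 : Type*}

/-- The local loss `ℒ_k(θ) = n_k⁻¹ ∑_{i ∈ 𝒮_k} ℒ(θ; Z_i)`. -/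
def localLoss (ℒ : Par p → 𝒵 → ℝ) (w : ℕ → ℕ → ℕ) (Z : ℕ → ℕ → Ω → 𝒵) (N k : ℕ) (ω : Ω)
    (θ : Par p) : ℝ :=
  ((shard w N k).card : ℝ)⁻¹ * ∑ i ∈ shard w N k, ℒ θ (Z N i ω)

/-- The distributed least squares loss
`N⁻¹ ∑_k (θ - θ̂_k)ᵀ {∑_{i ∈ 𝒮_k} ∇²ℒ(θ̂_k; Z_i)} (θ - θ̂_k)`. -/
def dlsaLoss (ℒ : Par p → 𝒵 → ℝ) (K : ℕ → ℕ) (w : ℕ → ℕ → ℕ) (Z : ℕ → ℕ → Ω → 𝒵)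
    (thetaHat : ℕ → ℕ → Ω → Par p) (N : ℕ) (ω : Ω) (θ : Par p) : ℝ :=
  (N : ℝ)⁻¹ * ∑ k ∈ Finset.range (K N),
    quadForm (∑ i ∈ shard w N k, hess (fun η => ℒ η (Z N i ω)) (thetaHat N k ω))
      (θ - thetaHat N k ω)

/-- The adaptive Lasso objective `Q_λ`. -/
def lassoObjective (ℒ : Par p → 𝒵 → ℝ) (K : ℕ → ℕ) (w : ℕ → ℕ → ℕ) (Z : ℕ → ℕ → Ω → 𝒵)
    (thetaHat : ℕ → ℕ → Ω → Par p) (lam : ℕ → Ω → Fin p → ℝ) (N : ℕ) (ω : Ω) (θ : Par p) : ℝ :=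
  dlsaLoss ℒ K w Z thetaHat N ω θ + ∑ j, lam N ω j * |θ j|

variable [MeasurableSpace Ω]

/-- `θ̂_k` is (almost surely) a minimizer of the local loss over the parameter space. -/
def IsLocalEstimator (P : Measure Ω) (Θ : Set (Par p)) (ℒ : Par p → 𝒵 → ℝ) (K : ℕ → ℕ)
    (w : ℕ → ℕ → ℕ) (Z : ℕ → ℕ → Ω → 𝒵) (thetaHat : ℕ → ℕ → Ω → Par p) : Prop :=
  ∀ N, ∀ k < K N, ∀ᵐ ω ∂P, thetaHat N k ω ∈ Θ ∧
    IsMinOn (localLoss ℒ w Z N k ω) Θ (thetaHat N k ω)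

/-- `θ̃_λ` is (almost surely) a minimizer of `Q_λ` over `ℝ^p` whenever `Q_λ` has one; nothing is
required of `θ̃_λ` on outcomes for which there is no minimizer. -/
def IsLassoEstimator (P : Measure Ω) (ℒ : Par p → 𝒵 → ℝ) (K : ℕ → ℕ) (w : ℕ → ℕ → ℕ)
    (Z : ℕ → ℕ → Ω → 𝒵) (thetaHat : ℕ → ℕ → Ω → Par p) (lam : ℕ → Ω → Fin p → ℝ)
    (thetaLam : ℕ → Ω → Par p) : Prop :=
  ∀ N, ∀ᵐ ω ∂P,
    (∃ θ, IsMinOn (lassoObjective ℒ K w Z thetaHat lam N ω) Set.univ θ) →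
      IsMinOn (lassoObjective ℒ K w Z thetaHat lam N ω) Set.univ (thetaLam N ω)

end Estimators

/-! ### The conditions on the parameter space and the loss -/

section Conditions

variable {p : ℕ} {Ω 𝒵 : Type*} [MeasurableSpace Ω] [MeasurableSpace 𝒵]

/-- (C1) Parameter space. -/
structure CondC1 (Θ : Set (Par p)) (θ₀ : Par p) : Prop where
  compact : IsCompact Θ
  convex : Convex ℝ Θ
  interior : θ₀ ∈ interior Θ

/-- (C3) Identifiability: for each `δ > 0` there is `ε > 0` such that, with probability tending to
one, `ℒ_k(θ) - ℒ_k(θ₀) ≥ ε` for all workers `k` and all `θ ∈ Θ` with `‖θ - θ₀‖ ≥ δ`; and the score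
at `θ₀` has mean zero on each worker. -/
structure CondC3 (P : Measure Ω) (μ : ℕ → Measure 𝒵) (Θ : Set (Par p)) (θ₀ : Par p)
    (ℒ : Par p → 𝒵 → ℝ) (K : ℕ → ℕ) (w : ℕ → ℕ → ℕ) (Z : ℕ → ℕ → Ω → 𝒵) : Prop where
  separated : ∀ δ : ℝ, 0 < δ → ∃ ε : ℝ, 0 < ε ∧ ProbTendstoOne P fun N =>
    {ω | ∀ k < K N, ∀ θ ∈ Θ, δ ≤ ‖θ - θ₀‖ →
      ε ≤ localLoss ℒ w Z N k ω θ - localLoss ℒ w Z N k ω θ₀}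
  score_integrable : ∀ N, ∀ k < K N, ∀ i,
    Integrable (fun z => pderiv i (fun θ => ℒ θ z) θ₀) (μ k)
  score_mean : ∀ N, ∀ k < K N, ∀ i, ∫ z, pderiv i (fun θ => ℒ θ z) θ₀ ∂(μ k) = 0

/-- The information matrix `Ω_k(θ) = E_k {∇²ℒ(θ; Z)}`. -/
def info (ν : Measure 𝒵) (ℒ : Par p → 𝒵 → ℝ) (θ : Par p) : Matrix (Fin p) (Fin p) ℝ :=
  Matrix.of fun i j => ∫ z, hess (fun η => ℒ η z) θ i j ∂ν

/-- (C4) Local convexity: on each worker the expected outer product of the score and the expected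
Hessian at `θ₀` exist, they agree, and the common matrix is nonsingular. -/
structure CondC4 (μ : ℕ → Measure 𝒵) (θ₀ : Par p) (ℒ : Par p → 𝒵 → ℝ) (K : ℕ → ℕ) : Prop where
  score_integrable : ∀ N, ∀ k < K N, ∀ i j, Integrable
    (fun z => pderiv i (fun θ => ℒ θ z) θ₀ * pderiv j (fun θ => ℒ θ z) θ₀) (μ k)
  hess_integrable : ∀ N, ∀ k < K N, ∀ i j,
    Integrable (fun z => hess (fun θ => ℒ θ z) θ₀ i j) (μ k)
  info_eq : ∀ N, ∀ k < K N, ∀ i j,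
    ∫ z, pderiv i (fun θ => ℒ θ z) θ₀ * pderiv j (fun θ => ℒ θ z) θ₀ ∂(μ k)
      = info (μ k) ℒ θ₀ i j
  nonsingular : ∀ N, ∀ k < K N, IsUnit (info (μ k) ℒ θ₀).det

/-- (C5) Smoothness: for almost every observation all third partial derivatives of the loss exist
in `{θ ∈ Θ : ‖θ - θ₀‖ ≤ δ}` and are bounded there by integrable functions `M i j l`. -/
structure CondC5 (μ : ℕ → Measure 𝒵) (Θ : Set (Par p)) (θ₀ : Par p) (ℒ : Par p → 𝒵 → ℝ)
    (K : ℕ → ℕ) (δ : ℝ) (M : Fin p → Fin p → Fin p → 𝒵 → ℝ) : Prop where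
  pos : 0 < δ
  third : ∀ N, ∀ k < K N, ∀ᵐ z ∂(μ k), ∀ θ ∈ Θ, ‖θ - θ₀‖ ≤ δ → ∀ i j l,
    HasPartial i (pderiv j (pderiv l fun η => ℒ η z)) θ ∧
      |pderiv i (pderiv j (pderiv l fun η => ℒ η z)) θ| ≤ M i j l z
  integrable : ∀ N, ∀ k < K N, ∀ i j l, Integrable (M i j l) (μ k)

/-- Uniformity over the workers, for a number of workers that is not bounded: the information
matrices are bounded away from singularity, and the second moments of the Hessian at `θ₀` and of
the bounds on the third derivatives are bounded, by constants that do not depend on the worker. -/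
def UniformOverWorkers (μ : ℕ → Measure 𝒵) (θ₀ : Par p) (ℒ : Par p → 𝒵 → ℝ) (K : ℕ → ℕ)
    (M : Fin p → Fin p → Fin p → 𝒵 → ℝ) : Prop :=
  ∃ c C : ℝ, 0 < c ∧ ∀ N, ∀ k < K N,
    (∀ v : Par p, c * ‖v‖ ^ 2 ≤ quadForm (info (μ k) ℒ θ₀) v) ∧
    (∀ i j, MemLp (fun z => hess (fun θ => ℒ θ z) θ₀ i j) 2 (μ k) ∧
      ∫ z, (hess (fun θ => ℒ θ z) θ₀ i j) ^ 2 ∂(μ k) ≤ C) ∧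
    (∀ i j l, MemLp (M i j l) 2 (μ k) ∧ ∫ z, (M i j l z) ^ 2 ∂(μ k) ≤ C)

end Conditions

/-- `a_λ = max {λ_j : j ≤ d₀}`. -/
def aLam {p : ℕ} (d₀ : ℕ) (l : Fin p → ℝ) : ℝ := ⨆ j : {j : Fin p // (j : ℕ) < d₀}, l j

/-- `b_λ = min {λ_j : j > d₀}`. -/
def bLam {p : ℕ} (d₀ : ℕ) (l : Fin p → ℝ) : ℝ := ⨅ j : {j : Fin p // d₀ ≤ (j : ℕ)}, l j

end DLSA

end

namespace DLSA

variable {p : ℕ}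

/-! ### Calculus in the parameter -/

/-! The distributed loss is exactly quadratic: with u = θ - θ₀ it equals q₀ + uᵀAu - 2bᵀu, where A =
N⁻¹ ∑ₖ Hₖ, b = N⁻¹ ∑ₖ Hₖ(θ̂ₖ - θ₀), and Hₖ sums the Hessians of the observations on worker k at θ̂ₖ.
Once A is bounded below by c > 0, has bounded entries, and b = O(N^{-1/2}) (`HasQuadExpansion`), the
rest is deterministic. Comparing the penalized minimizer with θ₀ gives the rate
(`norm_sub_le_of_isMinOn_penalized`). Setting to zero a coordinate with value s ≠ 0 that vanishes in
θ₀ saves λⱼ|s| and costs at most |s| · O(N^{-1/2}), so λⱼ = O(N^{-1/2}), which is impossible when √N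
b_λ → ∞ (`penalty_le_of_ne_zero`).

The bound on b is the heart of the matter (`exists_hasQuadExpansion`). Since θ̂ₖ is stationary,
Hₖ(θ̂ₖ - θ₀) is minus the score sum of worker k, up to an error of order nₖ‖θ̂ₖ - θ₀‖², which is at
most a multiple of nₖ|Sₖ|² for the mean score Sₖ (`local_expansion`). Summed over the workers, the
leading terms form the score of the full sample, which is O_p(√N). The errors have total expectation
O(K), which is O(√N) because n/√N → ∞ means K/√N → 0.

The local expansions must hold on all workers at once. Identifiability puts every θ̂ₖ near θ₀, and a
law of large numbers uniform in k (`probTendstoOne_shardMean`) controls the Hessians at θ₀ and the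
third derivative bounds. For bounded K this needs first moments only; otherwise Chebyshev's
inequality and a union bound cost O(K²/N) = o(1). -/

lemma sum_smul_single (v : Par p) : ∑ j, v j • EuclideanSpace.single j (1 : ℝ) = v := by
  simpa using (EuclideanSpace.basisFun (Fin p) ℝ).sum_repr v

lemma clm_apply_eq_sum {E : Type*} [NormedAddCommGroup E] [NormedSpace ℝ E] (L : Par p →L[ℝ] E)
    (v : Par p) : L v = ∑ j, v j • L (EuclideanSpace.single j (1 : ℝ)) := by
  conv_lhs => rw [← sum_smul_single v]
  simp

lemma abs_coord_le (v : Par p) (i : Fin p) : |v i| ≤ ‖v‖ := by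
  simpa using PiLp.norm_apply_le v i

lemma pderiv_eq_fderiv {f : Par p → ℝ} {θ : Par p} (h : DifferentiableAt ℝ f θ) (i : Fin p) :
    pderiv i f θ = fderiv ℝ f θ (EuclideanSpace.single i 1) :=
  h.lineDeriv_eq_fderiv

variable {U : Set (Par p)} {f : Par p → ℝ} {θ θ₀ : Par p}

/-- `pderiv` is a line derivative and equals the value of `fderiv` wherever `f` is differentiable.
Openness of `U` makes this an identity near `θ`, so both sides can be differentiated. -/
lemma TwiceDifferentiableOn.hasFDerivAt_pderiv (h : TwiceDifferentiableOn f U) (hU : IsOpen U)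
    (hθ : θ ∈ U) (j : Fin p) :
    HasFDerivAt (pderiv j f)
      ((ContinuousLinearMap.apply ℝ ℝ (EuclideanSpace.single j (1 : ℝ))).comp
        (fderiv ℝ (fderiv ℝ f) θ)) θ := by
  have h1 : HasFDerivAt (fun y => fderiv ℝ f y (EuclideanSpace.single j (1 : ℝ)))
      ((ContinuousLinearMap.apply ℝ ℝ (EuclideanSpace.single j (1 : ℝ))).comp
        (fderiv ℝ (fderiv ℝ f) θ)) θ :=
    (ContinuousLinearMap.apply ℝ ℝ (EuclideanSpace.single j (1 : ℝ))).hasFDerivAt.comp θ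
      (h θ hθ).2.hasFDerivAt
  refine h1.congr_of_eventuallyEq ?_
  filter_upwards [hU.mem_nhds hθ] with y hy
  exact pderiv_eq_fderiv (h y hy).1 j

lemma TwiceDifferentiableOn.hess_eq (h : TwiceDifferentiableOn f U) (hU : IsOpen U)
    (hθ : θ ∈ U) (i j : Fin p) :
    hess f θ i j = fderiv ℝ (fderiv ℝ f) θ (EuclideanSpace.single i 1)
      (EuclideanSpace.single j 1) := by
  have := h.hasFDerivAt_pderiv hU hθ j
  simp only [hess, Matrix.of_apply]
  rw [pderiv_eq_fderiv this.differentiableAt, this.fderiv]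
  simp

/-- A second Fréchet derivative at a point is symmetric without continuity of the second
derivatives. Symmetry lets the cross terms combine when the quadratic forms are recentred at `θ₀`.
-/
lemma TwiceDifferentiableOn.hess_symm (h : TwiceDifferentiableOn f U) (hU : IsOpen U)
    (hθ : θ ∈ U) (i j : Fin p) : hess f θ i j = hess f θ j i := by
  rw [h.hess_eq hU hθ, h.hess_eq hU hθ]
  refine second_derivative_symmetric_of_eventually (f := f) (f' := fderiv ℝ f) ?_
    (h θ hθ).2.hasFDerivAt _ _
  filter_upwards [hU.mem_nhds hθ] with y hy using (h y hy).1.hasFDerivAt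

/-- The derivative of a partial derivative along a line. -/
lemma TwiceDifferentiableOn.hasDerivAt_pderiv_line (h : TwiceDifferentiableOn f U) (hU : IsOpen U)
    (v : Par p) (t : ℝ) (ht : θ + t • v ∈ U) (i : Fin p) :
    HasDerivAt (fun s : ℝ => pderiv i f (θ + s • v)) (∑ j, v j * hess f (θ + t • v) j i) t := by
  have h1 := h.hasFDerivAt_pderiv hU ht i
  have h2 : HasDerivAt (fun s : ℝ => θ + s • v) v t := by
    simpa using ((hasDerivAt_id t).smul_const v).const_add θ
  have h3 := h1.comp_hasDerivAt t h2
  rw [clm_apply_eq_sum] at h3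
  refine h3.congr_deriv (Finset.sum_congr rfl fun j _ => ?_)
  rw [h.hess_eq hU ht]
  simp

/-! ### Derivatives of averages of losses -/

section Average

variable {ι : Type*} {F : ι → Par p → ℝ} (s : Finset ι) (a : ℝ)

lemma hasFDerivAt_average (h : ∀ i ∈ s, DifferentiableAt ℝ (F i) θ) :
    HasFDerivAt (fun η => a * ∑ i ∈ s, F i η) (a • ∑ i ∈ s, fderiv ℝ (F i) θ) θ := by
  exact (HasFDerivAt.fun_sum fun i hi => (h i hi).hasFDerivAt).const_mul a

lemma TwiceDifferentiableOn.average (hU : IsOpen U) (h : ∀ i ∈ s, TwiceDifferentiableOn (F i) U) :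
    TwiceDifferentiableOn (fun η => a * ∑ i ∈ s, F i η) U := by
  intro θ hθ
  refine ⟨(hasFDerivAt_average s a fun i hi => (h i hi θ hθ).1).differentiableAt, ?_⟩
  have h1 : DifferentiableAt ℝ (fun η => a • ∑ i ∈ s, fderiv ℝ (F i) η) θ :=
    (DifferentiableAt.fun_sum fun i hi => (h i hi θ hθ).2).const_smul a
  refine h1.congr_of_eventuallyEq ?_
  filter_upwards [hU.mem_nhds hθ] with y hy
  exact (hasFDerivAt_average s a fun i hi => (h i hi y hy).1).fderiv

lemma pderiv_average (h : ∀ i ∈ s, DifferentiableAt ℝ (F i) θ) (j : Fin p) :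
    pderiv j (fun η => a * ∑ i ∈ s, F i η) θ = a * ∑ i ∈ s, pderiv j (F i) θ := by
  have h1 := hasFDerivAt_average s a h
  rw [pderiv_eq_fderiv h1.differentiableAt, h1.fderiv]
  simp only [_root_.smul_apply, _root_.sum_apply, smul_eq_mul]
  congr 1
  exact Finset.sum_congr rfl fun i hi => (pderiv_eq_fderiv (h i hi) j).symm

lemma hess_average (hU : IsOpen U) (h : ∀ i ∈ s, TwiceDifferentiableOn (F i) U) (hθ : θ ∈ U)
    (j l : Fin p) :
    hess (fun η => a * ∑ i ∈ s, F i η) θ j l = a * ∑ i ∈ s, hess (F i) θ j l := by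
  have h1 : pderiv l (fun η => a * ∑ i ∈ s, F i η) =ᶠ[𝓝 θ]
      fun η => a * ∑ i ∈ s, pderiv l (F i) η := by
    filter_upwards [hU.mem_nhds hθ] with y hy
    exact pderiv_average s a (fun i hi => (h i hi y hy).1) l
  simp only [hess, Matrix.of_apply]
  rw [pderiv, h1.lineDeriv_eq]
  exact pderiv_average s a
    (fun i hi => ((h i hi).hasFDerivAt_pderiv hU hθ l).differentiableAt) j

end Average

/-- A function whose partial derivatives on a ball are bounded by `B i` changes from the centre
of the ball by at most `∑ i, B i * |θ i - θ₀ i|`. -/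
lemma abs_sub_le_of_partial_bound {g : Par p → ℝ} {r : ℝ} {B : Fin p → ℝ}
    (hg : ∀ η, ‖η - θ₀‖ ≤ r → ∀ i, HasPartial i g η ∧ |pderiv i g η| ≤ B i)
    (hθ : ‖θ - θ₀‖ ≤ r) : |g θ - g θ₀| ≤ ∑ i, B i * |θ i - θ₀ i| := by
  classical
  -- Only partial derivatives of `g` are available, so the path from `θ₀` to `θ` follows
  -- axis-parallel segments: `mix s` has already exchanged the coordinates in `s`.
  let mix : Finset (Fin p) → Par p := fun s => WithLp.toLp 2 fun i => if i ∈ s then θ i else θ₀ i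
  have key : ∀ s : Finset (Fin p), |g (mix s) - g θ₀| ≤ ∑ i ∈ s, B i * |θ i - θ₀ i| := by
    intro s
    induction s using Finset.induction_on with
    | empty =>
      have : mix ∅ = θ₀ := by ext i; simp [mix]
      simp [this]
    | insert a s ha ih =>
      set d : ℝ := θ a - θ₀ a with hd
      set e : Par p := EuclideanSpace.single a (1 : ℝ) with he
      have hend : mix (insert a s) = mix s + (1 : ℝ) • (d • e) := by
        ext i
        by_cases hi : i = a
        · subst hi; simp [mix, ha, he, hd]
        · simp [mix, he, hi, Finset.mem_insert]
      -- In each coordinate the path is no farther from `θ₀` than `θ` is, so it stays in the ball.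
      have hnorm : ∀ t ∈ Set.Icc (0 : ℝ) 1, ‖mix s + t • (d • e) - θ₀‖ ≤ r := by
        intro t ht
        refine le_trans ?_ hθ
        rw [EuclideanSpace.norm_eq, EuclideanSpace.norm_eq]
        refine Real.sqrt_le_sqrt (Finset.sum_le_sum fun i _ => ?_)
        refine pow_le_pow_left₀ (norm_nonneg _) ?_ 2
        by_cases hi : i = a
        · subst hi
          simp only [mix, he, hd, PiLp.sub_apply, PiLp.add_apply, PiLp.smul_apply, ha, if_false,
            PiLp.single_apply, if_true, smul_eq_mul, mul_one, Real.norm_eq_abs]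
          rw [add_sub_cancel_left, abs_mul, abs_of_nonneg ht.1]
          exact mul_le_of_le_one_left (abs_nonneg _) ht.2
        · by_cases his : i ∈ s <;> simp [mix, he, hi, his]
      have hder : ∀ t ∈ Set.Icc (0 : ℝ) 1, HasDerivAt (fun t : ℝ => g (mix s + t • (d • e)))
          (d * pderiv a g (mix s + t • (d • e))) t := by
        intro t ht
        -- A line derivative lives at parameter `0`; writing `0` as `t - t` allows a shift to `t`.
        have h1 : HasDerivAt (fun u : ℝ => g (mix s + t • (d • e) + u • (d • e)))
            (d • pderiv a g (mix s + t • (d • e))) (t - t) := by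
          rw [sub_self]
          exact (hg _ (hnorm t ht) a).1.hasLineDerivAt.smul d
        refine (h1.comp_sub_const t t).congr_of_eventuallyEq (Eventually.of_forall fun u => ?_)
        simp only [add_assoc, ← add_smul, add_sub_cancel]
      have h1 := norm_image_sub_le_of_norm_deriv_le_segment_01'
        (fun t ht => (hder t ht).hasDerivWithinAt) (C := B a * |d|) (by
          intro t ht
          rw [norm_mul, mul_comm]
          exact mul_le_mul_of_nonneg_right (hg _ (hnorm t ⟨ht.1, ht.2.le⟩) a).2 (norm_nonneg _))
      rw [← hend] at h1
      simp only [zero_smul, add_zero, Real.norm_eq_abs] at h1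
      rw [Finset.sum_insert ha]
      calc |g (mix (insert a s)) - g θ₀|
          ≤ |g (mix (insert a s)) - g (mix s)| + |g (mix s) - g θ₀| := abs_sub_le _ _ _
        _ ≤ _ := add_le_add h1 ih
  have huniv : mix Finset.univ = θ := by ext i; simp [mix]
  simpa [huniv] using key Finset.univ

/-! ### Quadratic forms -/

lemma quadForm_eq_sum_mul (A : Matrix (Fin p) (Fin p) ℝ) (v : Par p) :
    quadForm A v = ∑ i, v i * ∑ j, A i j * v j := by
  simp only [quadForm, Finset.mul_sum, mul_assoc]

lemma quadForm_eq_sum_mul' (A : Matrix (Fin p) (Fin p) ℝ) (v : Par p) :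
    quadForm A v = ∑ j, v j * ∑ i, v i * A i j := by
  simp only [quadForm, Finset.mul_sum]
  rw [Finset.sum_comm]
  exact Finset.sum_congr rfl fun i _ => Finset.sum_congr rfl fun j _ => by ring

/-- A crude bound whose factor `p` is harmless because the dimension is fixed; it allows matrices to
be controlled entry by entry throughout. -/
lemma abs_sum_mul_le {β : ℝ} {a : Fin p → ℝ} (ha : ∀ i, |a i| ≤ β) (v : Par p) :
    |∑ i, a i * v i| ≤ p * β * ‖v‖ := by
  calc |∑ i, a i * v i| ≤ ∑ i, |a i * v i| := Finset.abs_sum_le_sum_abs _ _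
    _ ≤ ∑ _i : Fin p, β * ‖v‖ := Finset.sum_le_sum fun i _ => by
        rw [abs_mul]
        exact mul_le_mul (ha i) (abs_coord_le v i) (abs_nonneg _) ((abs_nonneg _).trans (ha i))
    _ = p * β * ‖v‖ := by simp [mul_assoc]

lemma abs_quadForm_sub_le {A B : Matrix (Fin p) (Fin p) ℝ} {β : ℝ}
    (h : ∀ i j, |A i j - B i j| ≤ β) (v : Par p) :
    |quadForm A v - quadForm B v| ≤ p ^ 2 * β * ‖v‖ ^ 2 := by
  have h1 : quadForm A v - quadForm B v = ∑ i, (∑ j, (A i j - B i j) * v j) * v i := by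
    rw [quadForm_eq_sum_mul, quadForm_eq_sum_mul, ← Finset.sum_sub_distrib]
    refine Finset.sum_congr rfl fun i _ => ?_
    simp only [sub_mul, Finset.sum_sub_distrib]
    ring
  rw [h1]
  refine (abs_sum_mul_le (fun i => abs_sum_mul_le (h i) v) v).trans_eq ?_
  ring

lemma quadForm_lower {A B : Matrix (Fin p) (Fin p) ℝ} {β c : ℝ}
    (h : ∀ i j, |A i j - B i j| ≤ β) (hB : ∀ v, c * ‖v‖ ^ 2 ≤ quadForm B v) (v : Par p) :
    (c - p ^ 2 * β) * ‖v‖ ^ 2 ≤ quadForm A v := by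
  have h1 := (abs_le.1 (abs_quadForm_sub_le h v)).1
  have h2 := hB v
  rw [sub_mul]
  linarith

/-! ### Minimizers of a function with controlled Hessian -/

lemma pderiv_eq_zero_of_isMinOn {S : Set (Par p)} (hmin : IsMinOn f S θ) (hθ : θ ∈ interior S)
    (hf : DifferentiableAt ℝ f θ) (i : Fin p) : pderiv i f θ = 0 := by
  have : IsLocalMin f θ := hmin.isLocalMin (mem_interior_iff_mem_nhds.1 hθ)
  rw [pderiv_eq_fderiv hf, this.fderiv_eq_zero]
  simp

section Minimizer

variable {c L r : ℝ}

lemma norm_segment_le (hθ : ‖θ - θ₀‖ ≤ r) {t : ℝ} (ht : t ∈ Set.Icc (0 : ℝ) 1) :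
    ‖θ₀ + t • (θ - θ₀) - θ₀‖ ≤ ‖θ - θ₀‖ ∧ ‖θ₀ + t • (θ - θ₀) - θ₀‖ ≤ r := by
  have : ‖θ₀ + t • (θ - θ₀) - θ₀‖ ≤ ‖θ - θ₀‖ := by
    rw [add_sub_cancel_left, norm_smul, Real.norm_eq_abs, abs_of_nonneg ht.1]
    exact mul_le_of_le_one_left (norm_nonneg _) ht.2
  exact ⟨this, this.trans hθ⟩

/-- A stationary point near `θ₀` is as close to `θ₀` as the gradient at `θ₀` is small. -/
lemma norm_sub_le_of_stationary (hf : TwiceDifferentiableOn f U) (hU : IsOpen U)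
    (hball : ∀ η, ‖η - θ₀‖ ≤ r → η ∈ U)
    (hquad : ∀ η, ‖η - θ₀‖ ≤ r → ∀ v, c * ‖v‖ ^ 2 ≤ quadForm (hess f η) v)
    (hθ : ‖θ - θ₀‖ ≤ r) (hstat : ∀ i, pderiv i f θ = 0) {G : ℝ}
    (hG : ∀ i, |pderiv i f θ₀| ≤ G) : c * ‖θ - θ₀‖ ≤ p * G := by
  set v := θ - θ₀ with hv
  -- The mean value theorem is applied to the scalar function t ↦ ⟨v, ∇f(θ₀ + tv)⟩, which vanishes
  -- at t = 1. Hence -⟨v, ∇f(θ₀)⟩ is a value of the Hessian form at `v`, at least c‖v‖².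
  have hder : ∀ t ∈ Set.Icc (0 : ℝ) 1, HasDerivAt
      (fun t : ℝ => ∑ i, v i * pderiv i f (θ₀ + t • v))
      (quadForm (hess f (θ₀ + t • v)) v) t := by
    intro t ht
    rw [quadForm_eq_sum_mul']
    exact HasDerivAt.fun_sum fun i _ =>
      (hf.hasDerivAt_pderiv_line hU v t (hball _ (norm_segment_le hθ ht).2) i).const_mul _
  obtain ⟨t, ht, hslope⟩ := exists_hasDerivAt_eq_slope _ _ (zero_lt_one' ℝ)
    (fun t ht => (hder t ht).continuousAt.continuousWithinAt)
    (fun t ht => hder t ⟨ht.1.le, ht.2.le⟩)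
  have hend : θ₀ + (1 : ℝ) • v = θ := by simp [hv]
  simp only [hend, hstat, zero_smul, add_zero, mul_zero, Finset.sum_const_zero, sub_zero, div_one,
    zero_sub] at hslope
  have h1 := hquad _ (norm_segment_le hθ ⟨ht.1.le, ht.2.le⟩).2 v
  have h2 := (neg_le_abs _).trans (abs_sum_mul_le hG v)
  simp only [mul_comm (pderiv _ f θ₀)] at h2
  rw [← hv, hslope] at h1
  -- Cancelling ‖v‖ requires `v ≠ 0`. For `v = 0` the claim is 0 ≤ pG, where `G` is nonnegative as
  -- soon as there is a coordinate.
  rcases (norm_nonneg v).eq_or_lt with h0 | h0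
  · rw [← h0, mul_zero]
    rcases Nat.eq_zero_or_pos p with rfl | hp
    · simp
    · exact mul_nonneg (Nat.cast_nonneg _) ((abs_nonneg _).trans (hG ⟨0, hp⟩))
  · refine le_of_mul_le_mul_right ?_ h0
    nlinarith

/-- First order expansion of the gradient at `θ₀` around a stationary point. -/
lemma abs_hess_mul_add_le (hf : TwiceDifferentiableOn f U) (hU : IsOpen U)
    (hball : ∀ η, ‖η - θ₀‖ ≤ r → η ∈ U) (hL : 0 ≤ L)
    (hlip : ∀ η, ‖η - θ₀‖ ≤ r → ∀ i j, |hess f η i j - hess f θ₀ i j| ≤ L * ‖η - θ₀‖)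
    (hθ : ‖θ - θ₀‖ ≤ r) (hstat : ∀ i, pderiv i f θ = 0) (i : Fin p) :
    |∑ j, hess f θ i j * (θ - θ₀) j + pderiv i f θ₀| ≤ 2 * p * L * ‖θ - θ₀‖ ^ 2 := by
  set v := θ - θ₀ with hv
  have hder : ∀ t ∈ Set.Icc (0 : ℝ) 1, HasDerivAt
      (fun t : ℝ => pderiv i f (θ₀ + t • v)) (∑ j, v j * hess f (θ₀ + t • v) j i) t :=
    fun t ht => hf.hasDerivAt_pderiv_line hU v t (hball _ (norm_segment_le hθ ht).2) i
  obtain ⟨t, ht, hslope⟩ := exists_hasDerivAt_eq_slope _ _ (zero_lt_one' ℝ)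
    (fun t ht => (hder t ht).continuousAt.continuousWithinAt)
    (fun t ht => hder t ⟨ht.1.le, ht.2.le⟩)
  have hend : θ₀ + (1 : ℝ) • v = θ := by simp [hv]
  simp only [hend, hstat, zero_smul, add_zero, sub_zero, div_one, zero_sub] at hslope
  have hseg := norm_segment_le hθ (t := t) ⟨ht.1.le, ht.2.le⟩
  -- The mean value theorem yields the Hessian at an intermediate point, while the expansion needs
  -- it at `θ`. Both lie within L‖v‖ of the Hessian at `θ₀`, whence the factor 2.
  have hentry : ∀ j, |hess f θ i j - hess f (θ₀ + t • v) j i| ≤ 2 * (L * ‖v‖) := by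
    intro j
    rw [hf.hess_symm hU (hball _ hseg.2) j i]
    have h1 := hlip θ hθ i j
    have h2 := hlip _ hseg.2 i j
    have h3 := mul_le_mul_of_nonneg_left hseg.1 hL
    have h4 := abs_sub_le (hess f θ i j) (hess f θ₀ i j) (hess f (θ₀ + t • v) i j)
    rw [abs_sub_comm (hess f θ₀ i j)] at h4
    linarith
  have h1 : ∑ j, hess f θ i j * v j + pderiv i f θ₀ =
      ∑ j, (hess f θ i j - hess f (θ₀ + t • v) j i) * v j := by
    rw [← neg_neg (pderiv i f θ₀), ← hslope, ← sub_eq_add_neg, ← Finset.sum_sub_distrib]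
    exact Finset.sum_congr rfl fun j _ => by ring
  rw [h1]
  exact (abs_sum_mul_le hentry v).trans_eq (by ring)

end Minimizer

end DLSA

namespace DLSA

variable {p : ℕ}

/-! ### Recentring quadratic forms -/

lemma quadForm_add (A : Matrix (Fin p) (Fin p) ℝ) (u v : Par p) :
    quadForm A (u + v) =
      quadForm A u + ∑ i, (∑ j, (A i j + A j i) * u j) * v i + quadForm A v := by
  have h1 : ∑ i, (∑ j, (A i j + A j i) * u j) * v i
      = ∑ i, ∑ j, v i * A i j * u j + ∑ i, ∑ j, u i * A i j * v j := by
    rw [Finset.sum_comm (f := fun i j => u i * A i j * v j), ← Finset.sum_add_distrib]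
    refine Finset.sum_congr rfl fun i _ => ?_
    rw [← Finset.sum_add_distrib, Finset.sum_mul]
    exact Finset.sum_congr rfl fun j _ => by ring
  rw [h1]
  simp only [quadForm, ← Finset.sum_add_distrib]
  exact Finset.sum_congr rfl fun i _ => Finset.sum_congr rfl fun j _ => by
    simp only [PiLp.add_apply]; ring

lemma quadForm_neg (A : Matrix (Fin p) (Fin p) ℝ) (v : Par p) :
    quadForm A (-v) = quadForm A v := by
  simp [quadForm]

lemma quadForm_smul_single (A : Matrix (Fin p) (Fin p) ℝ) (s : ℝ) (j : Fin p) :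
    quadForm A (s • EuclideanSpace.single j 1) = s ^ 2 * A j j := by
  simp [quadForm, PiLp.single_apply, sq]
  ring

lemma continuous_quadForm (A : Matrix (Fin p) (Fin p) ℝ) : Continuous (quadForm A) := by
  unfold quadForm
  fun_prop

lemma quadForm_sum {ι : Type*} (s : Finset ι) (a : ℝ) (H : ι → Matrix (Fin p) (Fin p) ℝ)
    (v : Par p) : quadForm (a • ∑ k ∈ s, H k) v = a * ∑ k ∈ s, quadForm (H k) v := by
  simp only [quadForm, Matrix.smul_apply, Matrix.sum_apply, smul_eq_mul]
  rw [Finset.sum_comm (s := s), Finset.mul_sum]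
  refine Finset.sum_congr rfl fun i _ => ?_
  rw [Finset.sum_comm (s := s), Finset.mul_sum]
  refine Finset.sum_congr rfl fun j _ => ?_
  simp only [Finset.mul_sum, Finset.sum_mul]
  exact Finset.sum_congr rfl fun k _ => by ring

/-- A weighted sum of quadratic forms with different centres, expanded around `θ₀`. -/
lemma sum_quadForm_expand {ι : Type*} (s : Finset ι) (a : ℝ) (H : ι → Matrix (Fin p) (Fin p) ℝ)
    (hH : ∀ k ∈ s, ∀ i j, H k i j = H k j i) (θ : ι → Par p) (θ₀ u : Par p) :
    a * ∑ k ∈ s, quadForm (H k) (θ₀ + u - θ k) =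
      a * ∑ k ∈ s, quadForm (H k) (θ k - θ₀) + quadForm (a • ∑ k ∈ s, H k) u -
        2 * ∑ i, (a * ∑ k ∈ s, ∑ j, H k i j * (θ k - θ₀) j) * u i := by
  have h1 : ∀ k ∈ s, quadForm (H k) (θ₀ + u - θ k) = quadForm (H k) (θ k - θ₀) +
      quadForm (H k) u - 2 * ∑ i, (∑ j, H k i j * (θ k - θ₀) j) * u i := by
    intro k hk
    rw [show θ₀ + u - θ k = -(θ k - θ₀) + u by abel, quadForm_add, quadForm_neg]
    have : ∀ i, ∑ j, (H k i j + H k j i) * (-(θ k - θ₀)) j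
        = -2 * ∑ j, H k i j * (θ k - θ₀) j := by
      intro i
      rw [Finset.mul_sum]
      refine Finset.sum_congr rfl fun j _ => ?_
      rw [hH k hk j i]
      simp only [PiLp.neg_apply]
      ring
    simp only [this, mul_assoc, ← Finset.mul_sum]
    ring
  rw [Finset.sum_congr rfl h1, quadForm_sum, Finset.sum_sub_distrib, Finset.sum_add_distrib,
    ← Finset.mul_sum, Finset.sum_comm (s := s)]
  simp only [Finset.mul_sum, Finset.sum_mul, mul_add, mul_sub, mul_assoc]
  congr 1
  refine Finset.sum_congr rfl fun i _ => Finset.sum_congr rfl fun j _ =>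
    Finset.sum_congr rfl fun l _ => by ring

/-! ### Minimizers of a penalized quadratic -/

section Lasso

variable {A : Matrix (Fin p) (Fin p) ℝ} {b l : Fin p → ℝ} {q : Par p → ℝ} {θ₀ θ : Par p}
  {q₀ c B : ℝ}

/-- The quadratic part is coercive and the penalty is nonnegative and continuous. Existence matters
because the Lasso estimator is constrained only on outcomes for which a minimizer exists. -/
lemma exists_isMinOn_penalized
    (hq : ∀ u, q (θ₀ + u) = q₀ + quadForm A u - 2 * ∑ i, b i * u i) (hc : 0 < c)
    (hA : ∀ v, c * ‖v‖ ^ 2 ≤ quadForm A v) (hb : ∀ i, |b i| ≤ B) (hl : ∀ j, 0 ≤ l j) :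
    ∃ θ, IsMinOn (fun η => q η + ∑ j, l j * |η j|) Set.univ θ := by
  set g : Par p → ℝ := fun u => q (θ₀ + u) + ∑ j, l j * |(θ₀ + u) j| with hg
  have hcont : Continuous g := by
    have := continuous_quadForm A
    simp only [hg, hq]
    fun_prop
  have hlow : ∀ u, q₀ + ‖u‖ * (c * ‖u‖ - 2 * (p * B)) ≤ g u := by
    intro u
    have h1 := (le_abs_self _).trans (abs_sum_mul_le hb u)
    have h2 := hA u
    have h3 : 0 ≤ ∑ j, l j * |(θ₀ + u) j| :=
      Finset.sum_nonneg fun j _ => mul_nonneg (hl j) (abs_nonneg _)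
    simp only [hg, hq]
    nlinarith
  have htend : Tendsto g (cocompact _) atTop := by
    refine tendsto_atTop_mono hlow ?_
    have h0 : Tendsto (fun u : Par p => ‖u‖) (cocompact _) atTop := tendsto_norm_cocompact_atTop
    refine tendsto_atTop_add_const_left _ _ (h0.atTop_mul_atTop₀ ?_)
    exact tendsto_atTop_add_const_right _ _ (h0.const_mul_atTop hc)
  obtain ⟨u, hu⟩ := hcont.exists_forall_le htend
  refine ⟨θ₀ + u, fun η _ => ?_⟩
  have := hu (η - θ₀)
  simp only [hg, add_sub_cancel] at this
  exact this

/-- If the penalties on the support of `θ₀` are at most `a`, a penalized minimizer is within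
`(2 p B + p a) / c` of `θ₀`. -/
lemma norm_sub_le_of_isMinOn_penalized
    (hq : ∀ u, q (θ₀ + u) = q₀ + quadForm A u - 2 * ∑ i, b i * u i)
    (hA : ∀ v, c * ‖v‖ ^ 2 ≤ quadForm A v) (hb : ∀ i, |b i| ≤ B) (hB : 0 ≤ B)
    (hl : ∀ j, 0 ≤ l j) {a : ℝ} (ha : 0 ≤ a) (hla : ∀ j, θ₀ j ≠ 0 → l j ≤ a)
    (hmin : IsMinOn (fun η => q η + ∑ j, l j * |η j|) Set.univ θ) :
    c * ‖θ - θ₀‖ ≤ 2 * (p * B) + p * a := by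
  set u := θ - θ₀ with hu
  have hθ : θ = θ₀ + u := by simp [hu]
  have h0 := hmin (Set.mem_univ θ₀)
  have h00 := hq 0
  simp only [Set.mem_ofPred_eq] at h0
  simp only [add_zero, PiLp.zero_apply, mul_zero, Finset.sum_const_zero, sub_zero] at h00
  have hz : quadForm A 0 = 0 := by simp [quadForm]
  rw [hθ, hq, h00, hz] at h0
  have h1 := (le_abs_self _).trans (abs_sum_mul_le hb u)
  have h2 := hA u
  -- Leaving `θ₀` cannot reduce the penalty off its support; on the support each term drops by at
  -- most a‖u‖.
  have h3 : ∑ j, l j * |θ₀ j| - ∑ j, l j * |(θ₀ + u) j| ≤ p * a * ‖u‖ := by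
    rw [← Finset.sum_sub_distrib]
    calc _ ≤ ∑ _j : Fin p, a * ‖u‖ := Finset.sum_le_sum fun j _ => by
          by_cases hj : θ₀ j = 0
          · rw [hj, abs_zero, mul_zero, zero_sub]
            exact (neg_nonpos.2 (mul_nonneg (hl j) (abs_nonneg _))).trans
              (mul_nonneg ha (norm_nonneg _))
          · have h4 : |θ₀ j| - |(θ₀ + u) j| ≤ ‖u‖ := by
              refine (abs_sub_abs_le_abs_sub _ _).trans ?_
              rw [PiLp.add_apply, sub_add_cancel_left, abs_neg]
              exact abs_coord_le u j
            calc l j * |θ₀ j| - l j * |(θ₀ + u) j| = l j * (|θ₀ j| - |(θ₀ + u) j|) := by ring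
              _ ≤ l j * ‖u‖ := mul_le_mul_of_nonneg_left h4 (hl j)
              _ ≤ a * ‖u‖ := mul_le_mul_of_nonneg_right (hla j hj) (norm_nonneg _)
      _ = p * a * ‖u‖ := by simp [mul_assoc]
  rcases (norm_nonneg u).eq_or_lt with h4 | h4
  · rw [← h4, mul_zero]; positivity
  · refine le_of_mul_le_mul_right ?_ h4
    nlinarith

/-- A coordinate in which a penalized minimizer does not vanish, although `θ₀` does, carries a
small penalty. -/
lemma penalty_le_of_ne_zero
    (hq : ∀ u, q (θ₀ + u) = q₀ + quadForm A u - 2 * ∑ i, b i * u i)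
    {D : ℝ} (hA : ∀ i j, |A i j| ≤ D) (hb : ∀ i, |b i| ≤ B)
    (hmin : IsMinOn (fun η => q η + ∑ j, l j * |η j|) Set.univ θ) {j : Fin p}
    (hj₀ : θ₀ j = 0) (hj : θ j ≠ 0) :
    l j ≤ (2 * p + 1) * D * ‖θ - θ₀‖ + 2 * B := by
  set u := θ - θ₀ with hu
  have hθ : θ = θ₀ + u := by simp [hu]
  set e : Par p := EuclideanSpace.single j (1 : ℝ) with he
  set s := θ j with hs
  have hsu : s = u j := by simp [hu, hj₀, hs]
  -- The competitor is `θ` with its coordinate `j` set to zero. It saves exactly l j * |s|, and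
  -- every term of the change in the quadratic part carries a factor |s|, which finally cancels.
  have h0 := hmin (Set.mem_univ (θ₀ + (u + (-s) • e)))
  simp only [Set.mem_ofPred_eq] at h0
  have hpen : ∑ i, l i * |(θ₀ + (u + (-s) • e)) i| + l j * |s| = ∑ i, l i * |θ i| := by
    rw [← Finset.sum_erase_add Finset.univ (fun i => l i * |(θ₀ + (u + (-s) • e)) i|)
        (Finset.mem_univ j),
      ← Finset.sum_erase_add Finset.univ (fun i => l i * |θ i|) (Finset.mem_univ j)]
    have h1 : (θ₀ + (u + (-s) • e)) j = 0 := by simp [hj₀, hsu, he]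
    rw [h1, abs_zero, mul_zero, add_zero, ← hs]
    congr 1
    refine Finset.sum_congr rfl fun i hi => ?_
    have hij : i ≠ j := Finset.ne_of_mem_erase hi
    simp [hθ, he, hij]
  have hlin : ∑ i, b i * (u + (-s) • e) i = ∑ i, b i * u i - s * b j := by
    simp [he, PiLp.single_apply, mul_add, Finset.sum_add_distrib]
    ring
  have hcross : ∑ i, (∑ m, (A i m + A m i) * u m) * ((-s) • e) i
      = -s * ∑ m, (A j m + A m j) * u m := by
    simp [he, PiLp.single_apply]
    ring
  have hq1 : q θ = q₀ + quadForm A u - 2 * ∑ i, b i * u i := by rw [← hq, hθ]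
  rw [← hpen, hq1, hq, quadForm_add, hlin, hcross, quadForm_smul_single] at h0
  have h2 : |∑ m, (A j m + A m j) * u m| ≤ p * (D + D) * ‖u‖ :=
    abs_sum_mul_le (fun m => (abs_add_le _ _).trans (add_le_add (hA j m) (hA m j))) u
  have hspos : 0 < |s| := abs_pos.2 hj
  have hsle : |s| ≤ ‖u‖ := by rw [hsu]; exact abs_coord_le u j
  have h3 : -s * ∑ m, (A j m + A m j) * u m ≤ |s| * (p * (D + D) * ‖u‖) := by
    refine (le_abs_self _).trans ?_
    rw [abs_mul, abs_neg]
    exact mul_le_mul_of_nonneg_left h2 hspos.le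
  have h4 : (-s) ^ 2 * A j j ≤ |s| * (‖u‖ * D) := by
    rw [neg_sq, ← sq_abs, sq, mul_assoc]
    refine mul_le_mul_of_nonneg_left ?_ hspos.le
    exact (mul_le_mul_of_nonneg_left ((le_abs_self _).trans (hA j j)) hspos.le).trans
      (mul_le_mul_of_nonneg_right hsle ((abs_nonneg _).trans (hA j j)))
  have h5 : s * b j ≤ |s| * B := by
    refine (le_abs_self _).trans ?_
    rw [abs_mul]
    exact mul_le_mul_of_nonneg_left (hb j) hspos.le
  refine le_of_mul_le_mul_left ?_ hspos
  nlinarith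

end Lasso

end DLSA

namespace DLSA

/-! ### Shard means and laws of large numbers -/

section Sample

variable {Ω 𝒵 : Type*} [MeasurableSpace Ω] [MeasurableSpace 𝒵] {P : Measure Ω}
  {μ : ℕ → Measure 𝒵} {K : ℕ → ℕ} {w : ℕ → ℕ → ℕ} {Z : ℕ → ℕ → Ω → 𝒵} {f : 𝒵 → ℝ} {N k : ℕ}

/-- The mean of `f` over the observations on worker `k`. -/
noncomputable def shardMean (f : 𝒵 → ℝ) (w : ℕ → ℕ → ℕ) (Z : ℕ → ℕ → Ω → 𝒵) (N k : ℕ) (ω : Ω) : ℝ :=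
  ((shard w N k).card : ℝ)⁻¹ * ∑ i ∈ shard w N k, f (Z N i ω)

lemma mem_shard {i : ℕ} : i ∈ shard w N k ↔ i < N ∧ w N i = k := by
  simp [shard]

lemma measure_ge_le_integral_div {X : Ω → ℝ} (hX : 0 ≤ᵐ[P] X) (hint : Integrable X P)
    [IsFiniteMeasure P] {ε : ℝ} (hε : 0 < ε) :
    P {ω | ε ≤ X ω} ≤ ENNReal.ofReal ((∫ ω, X ω ∂P) / ε) := by
  rw [← ENNReal.ofReal_toReal (measure_ne_top P {ω | ε ≤ X ω})]
  refine ENNReal.ofReal_le_ofReal ?_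
  rw [le_div_iff₀ hε, mul_comm]
  exact mul_meas_ge_le_integral_of_nonneg hX hint ε

lemma exists_pos_ofReal_div_le (C₀ : ℝ) {ε : ENNReal} (hε : 0 < ε) :
    ∃ D : ℝ, 0 < D ∧ ENNReal.ofReal (C₀ / D) ≤ ε := by
  have h : Tendsto (fun D : ℝ => ENNReal.ofReal (C₀ / D)) atTop (𝓝 0) := by
    rw [← ENNReal.ofReal_zero]
    exact ENNReal.tendsto_ofReal (tendsto_const_nhds.div_atTop tendsto_id)
  obtain ⟨D, hD, hD0⟩ := ((h.eventually_le_const hε).and (eventually_gt_atTop 0)).exists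
  exact ⟨D, hD0, hD⟩

namespace IsSample

variable (hS : IsSample P μ w Z)
include hS

lemma integrable_comp {i : ℕ} (hi : i < N) (hf : Integrable f (μ (w N i))) :
    Integrable (fun ω => f (Z N i ω)) P := by
  rw [← hS.law N i hi] at hf
  exact hf.comp_measurable (hS.measurable N i hi)

lemma memLp_comp {i : ℕ} (hi : i < N) {q : ENNReal} (hf : MemLp f q (μ (w N i))) :
    MemLp (fun ω => f (Z N i ω)) q P := by
  rw [← hS.law N i hi] at hf
  exact hf.comp_measurePreserving ⟨hS.measurable N i hi, rfl⟩

lemma integral_comp {i : ℕ} (hi : i < N) (hf : AEStronglyMeasurable f (μ (w N i))) :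
    ∫ ω, f (Z N i ω) ∂P = ∫ z, f z ∂(μ (w N i)) := by
  rw [← hS.law N i hi] at hf ⊢
  exact (integral_map (hS.measurable N i hi).aemeasurable hf).symm

lemma ae_comp {i : ℕ} (hi : i < N) {Q : 𝒵 → Prop} (hQ : ∀ᵐ z ∂(μ (w N i)), Q z) :
    ∀ᵐ ω ∂P, Q (Z N i ω) := by
  rw [← hS.law N i hi] at hQ
  exact ae_of_ae_map (hS.measurable N i hi).aemeasurable hQ

lemma indepFun {i j : ℕ} (hi : i < N) (hj : j < N) (hij : i ≠ j) :
    IndepFun (Z N i) (Z N j) P :=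
  (hS.indep N).indepFun (i := ⟨i, hi⟩) (j := ⟨j, hj⟩) (by simpa using hij)

/-- The index set is arbitrary and the laws may differ, so that the bound serves a single shard as
well as the whole sample. -/
lemma variance_sum_le [IsProbabilityMeasure P] {s : Finset ℕ} (hs : ∀ i ∈ s, i < N)
    (hf : ∀ i ∈ s, MemLp f 2 (μ (w N i))) {C : ℝ}
    (hC : ∀ i ∈ s, ∫ z, f z ^ 2 ∂(μ (w N i)) ≤ C) :
    Var[∑ i ∈ s, fun ω => f (Z N i ω); P] ≤ s.card * C := by
  rw [IndepFun.variance_sum (fun i hi => hS.memLp_comp (hs i hi) (hf i hi))]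
  · rw [← nsmul_eq_mul]
    refine Finset.sum_le_card_nsmul _ _ _ fun i hi => ?_
    have h1 := hS.memLp_comp (hs i hi) (hf i hi)
    refine (variance_le_expectation_sq h1.1).trans ?_
    have h2 := hS.integral_comp (f := fun z => f z ^ 2) (hs i hi) ((hf i hi).1.pow 2)
    simp only [Pi.pow_apply]
    rw [h2]
    exact hC i hi
  · intro i hi j hj hij
    have hi' := hs i hi
    have hj' := hs j hj
    refine IndepFun.comp₀ (hS.indepFun hi' hj' hij) (hS.measurable N i hi').aemeasurable
      (hS.measurable N j hj').aemeasurable ?_ ?_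
    · rw [hS.law N i hi']; exact (hf i hi).1.aemeasurable
    · rw [hS.law N j hj']; exact (hf j hj).1.aemeasurable

lemma integral_sum {s : Finset ℕ} (hs : ∀ i ∈ s, i < N)
    (hf : ∀ i ∈ s, Integrable f (μ (w N i))) :
    ∫ ω, ∑ i ∈ s, f (Z N i ω) ∂P = ∑ i ∈ s, ∫ z, f z ∂(μ (w N i)) := by
  rw [integral_finsetSum _ fun i hi => hS.integrable_comp (hs i hi) (hf i hi)]
  exact Finset.sum_congr rfl fun i hi => hS.integral_comp (hs i hi) (hf i hi).1

lemma integral_sum_sq_le [IsProbabilityMeasure P] [∀ k, IsProbabilityMeasure (μ k)]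
    {s : Finset ℕ} (hs : ∀ i ∈ s, i < N)
    (hf : ∀ i ∈ s, MemLp f 2 (μ (w N i))) (hf0 : ∀ i ∈ s, ∫ z, f z ∂(μ (w N i)) = 0) {C : ℝ}
    (hC : ∀ i ∈ s, ∫ z, f z ^ 2 ∂(μ (w N i)) ≤ C) :
    Integrable (fun ω => (∑ i ∈ s, f (Z N i ω)) ^ 2) P ∧
      ∫ ω, (∑ i ∈ s, f (Z N i ω)) ^ 2 ∂P ≤ s.card * C := by
  have hmem : MemLp (fun ω => ∑ i ∈ s, f (Z N i ω)) 2 P :=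
    memLp_finsetSum s fun i hi => hS.memLp_comp (hs i hi) (hf i hi)
  refine ⟨hmem.integrable_sq, ?_⟩
  have h1 := hS.variance_sum_le hs hf hC
  have h2 : (∑ i ∈ s, fun ω => f (Z N i ω)) = fun ω => ∑ i ∈ s, f (Z N i ω) := by
    ext ω; simp
  have h3 : ∫ ω, ∑ i ∈ s, f (Z N i ω) ∂P = 0 := by
    rw [hS.integral_sum hs fun i hi => (hf i hi).integrable (by norm_num)]
    exact Finset.sum_eq_zero hf0
  rw [h2, variance_eq_integral hmem.1.aemeasurable, h3] at h1
  simpa using h1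

/-- Chebyshev's inequality for a shard mean. -/
lemma measure_shardMean_sub_ge_le [IsProbabilityMeasure P] [∀ k, IsProbabilityMeasure (μ k)]
    (hn : 0 < (shard w N k).card) (hf : MemLp f 2 (μ k)) {C : ℝ}
    (hC : ∫ z, f z ^ 2 ∂(μ k) ≤ C) {ε : ℝ} (hε : 0 < ε) :
    P {ω | ε ≤ |shardMean f w Z N k ω - ∫ z, f z ∂(μ k)|} ≤
      ENNReal.ofReal (C / ((shard w N k).card * ε ^ 2)) := by
  set s := shard w N k with hsdef
  have hs : ∀ i ∈ s, i < N := fun i hi => (mem_shard.1 hi).1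
  have hw : ∀ i ∈ s, w N i = k := fun i hi => (mem_shard.1 hi).2
  have hn' : (0 : ℝ) < s.card := by exact_mod_cast hn
  have hf' : ∀ i ∈ s, MemLp f 2 (μ (w N i)) := fun i hi => by rw [hw i hi]; exact hf
  have hmem : MemLp (∑ i ∈ s, fun ω => f (Z N i ω)) 2 P :=
    memLp_finsetSum' s fun i hi => hS.memLp_comp (hs i hi) (hf' i hi)
  have h2 : (∑ i ∈ s, fun ω => f (Z N i ω)) = fun ω => ∑ i ∈ s, f (Z N i ω) := by
    ext ω; simp
  have hmean : ∫ ω, (∑ i ∈ s, fun ω => f (Z N i ω)) ω ∂P = s.card * ∫ z, f z ∂(μ k) := by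
    rw [h2, hS.integral_sum hs fun i hi => (hf' i hi).integrable (by norm_num),
      Finset.sum_congr rfl fun i hi => by rw [hw i hi]]
    simp
  have h1 := hS.variance_sum_le hs hf' (C := C) (fun i hi => by rw [hw i hi]; exact hC)
  have h3 := meas_ge_le_variance_div_sq hmem (mul_pos hn' hε)
  rw [hmean] at h3
  refine le_trans (measure_mono fun ω hω => ?_) (h3.trans (ENNReal.ofReal_le_ofReal ?_))
  · simp only [Set.mem_ofPred_eq, shardMean, ← hsdef] at hω ⊢
    have : (∑ i ∈ s, fun ω => f (Z N i ω)) ω - s.card * ∫ z, f z ∂(μ k)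
        = s.card * ((s.card : ℝ)⁻¹ * ∑ i ∈ s, f (Z N i ω) - ∫ z, f z ∂(μ k)) := by
      rw [mul_sub, ← mul_assoc, mul_inv_cancel₀ hn'.ne', one_mul, h2]
    rw [this, abs_mul, abs_of_pos hn']
    exact mul_le_mul_of_nonneg_left hω hn'.le
  · calc Var[∑ i ∈ s, fun ω => f (Z N i ω); P] / (s.card * ε) ^ 2
        ≤ s.card * C / (s.card * ε) ^ 2 := by gcongr
      _ = C / (s.card * ε ^ 2) := by field_simp

/-- The weak law of large numbers for shard means, uniformly in the stage. -/
lemma exists_measure_shardMean_sub_ge_le [IsProbabilityMeasure P]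
    [∀ k, IsProbabilityMeasure (μ k)] (hf : Integrable f (μ k)) {ε : ℝ} (hε : 0 < ε)
    {η : ENNReal} (hη : 0 < η) :
    ∃ m : ℝ, ∀ N, m ≤ (shard w N k).card →
      P {ω | ε ≤ |shardMean f w Z N k ω - ∫ z, f z ∂(μ k)|} ≤ η := by
  -- Truncation argument: `f` is replaced by a simple function `g` at L¹ distance less than `τ`.
  -- Chebyshev applies to `g`, Markov to the shard mean of |f - g| (hence the bound on τ / (ε / 3)),
  -- and τ < ε / 3 covers the difference of the two expectations.
  obtain ⟨τ, hτ, hτη, hτε⟩ : ∃ τ : ℝ, 0 < τ ∧ ENNReal.ofReal (τ / (ε / 3)) ≤ η / 2 ∧ τ < ε / 3 := by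
    have h : Tendsto (fun τ : ℝ => ENNReal.ofReal (τ / (ε / 3))) (𝓝[>] 0) (𝓝 0) := by
      have : Tendsto (fun τ : ℝ => τ / (ε / 3)) (𝓝[>] 0) (𝓝 0) := by
        have := (tendsto_id (α := ℝ) (x := 𝓝 0)).div_const (ε / 3)
        rw [zero_div] at this
        exact this.mono_left nhdsWithin_le_nhds
      simpa using ENNReal.tendsto_ofReal this
    obtain ⟨τ, h1, h2, h3⟩ := ((h.eventually_le_const (ENNReal.half_pos hη.ne')).and
      (Ioo_mem_nhdsGT (show (0 : ℝ) < ε / 3 by positivity))).exists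
    exact ⟨τ, h2, h1, h3⟩
  obtain ⟨g, hg, -⟩ := (memLp_one_iff_integrable.2 hf).exists_simpleFunc_eLpNorm_sub_lt
    ENNReal.one_ne_top (ε := ENNReal.ofReal τ) (by simpa using hτ)
  have hg2 : MemLp g 2 (μ k) := g.memLp_of_isFiniteMeasure 2 _
  have hg1 : Integrable g (μ k) := hg2.integrable (by norm_num)
  have hd : Integrable (fun z => |f z - g z|) (μ k) := (hf.sub hg1).abs
  have hdτ : ∫ z, |f z - g z| ∂(μ k) ≤ τ := by
    have h1 := ofReal_integral_norm_eq_lintegral_enorm (hf.sub hg1)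
    rw [eLpNorm_one_eq_lintegral_enorm, ← h1, ENNReal.ofReal_lt_ofReal_iff hτ] at hg
    exact hg.le
  obtain ⟨D, hD, hDη⟩ := exists_pos_ofReal_div_le ((∫ z, g z ^ 2 ∂(μ k)) / (ε / 3) ^ 2)
    (ENNReal.half_pos hη.ne')
  refine ⟨D, fun N hN => ?_⟩
  have hn' : (0 : ℝ) < (shard w N k).card := hD.trans_le hN
  have hn : 0 < (shard w N k).card := by exact_mod_cast hn'
  have hw : ∀ i ∈ shard w N k, w N i = k := fun i hi => (mem_shard.1 hi).2
  have hs : ∀ i ∈ shard w N k, i < N := fun i hi => (mem_shard.1 hi).1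
  have h1 := hS.measure_shardMean_sub_ge_le hn hg2 le_rfl (show 0 < ε / 3 by positivity)
  have hint : Integrable (shardMean (fun z => |f z - g z|) w Z N k) P :=
    (integrable_finsetSum _ fun i hi =>
      hS.integrable_comp (f := fun z => |f z - g z|) (hs i hi) (by rw [hw i hi]; exact hd)).const_mul _
  have hval : ∫ ω, shardMean (fun z => |f z - g z|) w Z N k ω ∂P = ∫ z, |f z - g z| ∂(μ k) := by
    simp only [shardMean]
    rw [integral_const_mul, hS.integral_sum (f := fun z => |f z - g z|) hs
      (fun i hi => by rw [hw i hi]; exact hd), Finset.sum_congr rfl fun i hi => by rw [hw i hi]]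
    simp only [Finset.sum_const, nsmul_eq_mul]
    rw [← mul_assoc, inv_mul_cancel₀ hn'.ne', one_mul]
  have h2 := measure_ge_le_integral_div (P := P) (Eventually.of_forall fun ω =>
    mul_nonneg (inv_nonneg.2 hn'.le) (Finset.sum_nonneg fun i _ => abs_nonneg _)) hint
    (show 0 < ε / 3 by positivity)
  have hsub : {ω | ε ≤ |shardMean f w Z N k ω - ∫ z, f z ∂(μ k)|} ⊆
      {ω | ε / 3 ≤ |shardMean g w Z N k ω - ∫ z, g z ∂(μ k)|} ∪
        {ω | ε / 3 ≤ shardMean (fun z => |f z - g z|) w Z N k ω} := by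
    intro ω hω
    by_contra hcon
    simp only [Set.mem_union, Set.mem_ofPred_eq, not_or, not_le] at hcon hω
    have h3 : |shardMean f w Z N k ω - shardMean g w Z N k ω| ≤
        shardMean (fun z => |f z - g z|) w Z N k ω := by
      simp only [shardMean]
      rw [← mul_sub, ← Finset.sum_sub_distrib, abs_mul, abs_of_pos (inv_pos.2 hn')]
      exact mul_le_mul_of_nonneg_left (Finset.abs_sum_le_sum_abs _ _) (inv_pos.2 hn').le
    have h4 : |∫ z, g z ∂(μ k) - ∫ z, f z ∂(μ k)| ≤ τ := by
      rw [abs_sub_comm, ← integral_sub hf hg1]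
      exact (abs_integral_le_integral_abs).trans hdτ
    have h5 := abs_sub_le (shardMean f w Z N k ω) (shardMean g w Z N k ω) (∫ z, f z ∂(μ k))
    have h6 := abs_sub_le (shardMean g w Z N k ω) (∫ z, g z ∂(μ k)) (∫ z, f z ∂(μ k))
    linarith [hcon.1, hcon.2]
  calc _ ≤ _ := measure_mono hsub
    _ ≤ _ := measure_union_le _ _
    _ ≤ η / 2 + η / 2 := by
      refine add_le_add (h1.trans (le_trans (ENNReal.ofReal_le_ofReal ?_) hDη)) (h2.trans (le_trans
        (ENNReal.ofReal_le_ofReal ?_) hτη))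
      · rw [div_div, mul_comm ((ε / 3) ^ 2)]
        have : 0 ≤ ∫ z, g z ^ 2 ∂(μ k) := integral_nonneg fun z => sq_nonneg _
        gcongr
      · simp only [shardMean] at hval
        rw [hval]
        gcongr
    _ = η := ENNReal.add_halves η

end IsSample

/-! ### Balanced designs -/

/-- As N = √N · √N, the quantity (N / K) / √N is the reciprocal of K / √N; with division by zero
read as zero this also holds for N = 0 or K = 0. -/
lemma tendsto_workers_div_sqrt
    (hrate : Tendsto (fun N : ℕ => ((N : ℝ) / K N) / √(N : ℝ)) atTop atTop) :
    Tendsto (fun N : ℕ => (K N : ℝ) / √(N : ℝ)) atTop (𝓝 0) := by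
  refine hrate.inv_tendsto_atTop.congr fun N => ?_
  rcases Nat.eq_zero_or_pos N with rfl | hN
  · simp
  · have h : (0 : ℝ) < √(N : ℝ) := Real.sqrt_pos.2 (by exact_mod_cast hN)
    rw [Pi.inv_apply, inv_div, div_div_eq_mul_div]
    rw [div_eq_div_iff (by exact_mod_cast hN.ne') h.ne']
    nth_rewrite 3 [← Real.mul_self_sqrt (Nat.cast_nonneg N)]
    ring

lemma IsBalancedDesign.workers_pos (hd : IsBalancedDesign K w) (hN : 0 < N) : 0 < K N :=
  (Nat.zero_le _).trans_lt (hd.worker_lt N 0 hN)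

/-- Shard sizes are bounded below by a multiple of `N / K`. -/
lemma IsBalancedDesign.exists_shard_card_lower (hd : IsBalancedDesign K w) :
    ∃ c : ℝ, 0 < c ∧ ∀ N, 0 < N → ∀ k < K N,
      0 < (N : ℝ) / K N ∧ c * ((N : ℝ) / K N) ≤ (shard w N k).card := by
  obtain ⟨c, _, hc, _, h⟩ := hd.balanced
  refine ⟨c, hc, fun N hN k hk => ⟨?_, (h N k hk).1⟩⟩
  have h1 : (0 : ℝ) < N := by exact_mod_cast hN
  have h2 : (0 : ℝ) < K N := by exact_mod_cast hd.workers_pos hN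
  positivity

lemma IsBalancedDesign.shard_card_pos (hd : IsBalancedDesign K w) (hN : 0 < N) (hk : k < K N) :
    0 < (shard w N k).card := by
  obtain ⟨c, hc, h⟩ := hd.exists_shard_card_lower
  have h1 := h N hN k hk
  exact_mod_cast (mul_pos hc h1.1).trans_le h1.2

lemma tendsto_average_size
    (hrate : Tendsto (fun N : ℕ => ((N : ℝ) / K N) / √(N : ℝ)) atTop atTop) :
    Tendsto (fun N : ℕ => (N : ℝ) / K N) atTop atTop := by
  refine tendsto_atTop_mono' _ ?_ hrate
  filter_upwards [eventually_ge_atTop 1] with N hN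
  exact div_le_self (by positivity) (Real.one_le_sqrt.2 (by exact_mod_cast hN))

lemma sum_shard_eq_sum_range (hd : IsBalancedDesign K w) (N : ℕ) (g : ℕ → ℝ) :
    ∑ k ∈ Finset.range (K N), ∑ i ∈ shard w N k, g i = ∑ i ∈ Finset.range N, g i :=
  Finset.sum_fiberwise_of_maps_to (g := fun i => w N i)
    (fun i hi => Finset.mem_range.2 (hd.worker_lt N i (Finset.mem_range.1 hi))) g

/-! ### Uniform laws of large numbers -/

/-- `f` is integrable on finitely many workers, or has uniformly bounded second moments. -/
def HasMomentBounds (f : 𝒵 → ℝ) (μ : ℕ → Measure 𝒵) (K : ℕ → ℕ) : Prop :=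
  ((∃ B : ℕ, ∀ N, K N ≤ B) ∧ ∀ N, ∀ k < K N, Integrable f (μ k)) ∨
    ∃ C : ℝ, ∀ N, ∀ k < K N, MemLp f 2 (μ k) ∧ ∫ z, f z ^ 2 ∂(μ k) ≤ C

lemma ProbTendstoOne.mono {A A' : ℕ → Set Ω} (h : ProbTendstoOne P A)
    (hsub : ∀ᶠ N in atTop, A N ⊆ A' N) : ProbTendstoOne P A' := by
  refine tendsto_of_tendsto_of_tendsto_of_le_of_le' tendsto_const_nhds h
    (Eventually.of_forall fun _ => zero_le) ?_
  filter_upwards [hsub] with N hN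
  exact measure_mono (Set.compl_subset_compl.2 hN)

lemma ProbTendstoOne.inter {A A' : ℕ → Set Ω} (h : ProbTendstoOne P A)
    (h' : ProbTendstoOne P A') : ProbTendstoOne P fun N => A N ∩ A' N := by
  have h1 := Tendsto.add h h'
  rw [add_zero] at h1
  refine tendsto_of_tendsto_of_tendsto_of_le_of_le tendsto_const_nhds h1
    (fun _ => zero_le) fun N => ?_
  simp only [Set.compl_inter]
  exact measure_union_le _ _

lemma ProbTendstoOne.of_ae {Q : ℕ → Ω → Prop} (h : ∀ N, ∀ᵐ ω ∂P, Q N ω) :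
    ProbTendstoOne P fun N => {ω | Q N ω} := by
  have : ∀ N, P {ω | Q N ω}ᶜ = 0 := fun N => ae_iff.1 (h N)
  simp [ProbTendstoOne, this]

lemma ProbTendstoOne.forall {ι : Type*} [Finite ι] {A : ι → ℕ → Set Ω}
    (h : ∀ i, ProbTendstoOne P (A i)) : ProbTendstoOne P fun N => {ω | ∀ i, ω ∈ A i N} := by
  have := Fintype.ofFinite ι
  have h1 := tendsto_finsetSum Finset.univ fun i _ => h i
  rw [Finset.sum_const_zero] at h1
  refine tendsto_of_tendsto_of_tendsto_of_le_of_le tendsto_const_nhds h1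
    (fun _ => zero_le) fun N => ?_
  refine (measure_mono fun ω hω => ?_).trans
    (measure_biUnion_finset_le Finset.univ fun i => (A i N)ᶜ)
  simpa using hω

/-- Shard means converge to their expectations, uniformly over the workers. -/
theorem probTendstoOne_shardMean [IsProbabilityMeasure P] [∀ k, IsProbabilityMeasure (μ k)]
    (hS : IsSample P μ w Z) (hd : IsBalancedDesign K w)
    (hrate : Tendsto (fun N : ℕ => ((N : ℝ) / K N) / √(N : ℝ)) atTop atTop)
    (hf : HasMomentBounds f μ K) {ε : ℝ} (hε : 0 < ε) :
    ProbTendstoOne P fun N =>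
      {ω | ∀ k < K N, |shardMean f w Z N k ω - ∫ z, f z ∂(μ k)| < ε} := by
  obtain ⟨c, hc, hcard⟩ := hd.exists_shard_card_lower
  have hunion : ∀ N, P {ω | ∀ k < K N, |shardMean f w Z N k ω - ∫ z, f z ∂(μ k)| < ε}ᶜ ≤
      ∑ k ∈ Finset.range (K N), P {ω | ε ≤ |shardMean f w Z N k ω - ∫ z, f z ∂(μ k)|} := by
    intro N
    refine (measure_mono fun ω hω => ?_).trans (measure_biUnion_finset_le _ _)
    simpa using hω
  rw [ProbTendstoOne, ENNReal.tendsto_nhds_zero]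
  intro η hη
  rcases hf with ⟨⟨B, hB⟩, hint⟩ | ⟨C, hC⟩
  · have hη' : 0 < η / (B + 1 : ℕ) := ENNReal.div_pos hη.ne' (ENNReal.natCast_ne_top _)
    -- `m k` is the shard size beyond which worker `k` meets its share of `η`; an index that is
    -- never used gets a dummy value. Finitely many thresholds are eventually all exceeded.
    have hm : ∀ k, ∃ m : ℝ, (∃ N, k < K N) → ∀ N, m ≤ (shard w N k).card →
        P {ω | ε ≤ |shardMean f w Z N k ω - ∫ z, f z ∂(μ k)|} ≤ η / (B + 1 : ℕ) := by
      intro k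
      by_cases hk : ∃ N, k < K N
      · obtain ⟨N, hN⟩ := hk
        obtain ⟨m, hm⟩ := hS.exists_measure_shardMean_sub_ge_le (hint N k hN) hε hη'
        exact ⟨m, fun _ => hm⟩
      · exact ⟨0, fun h => absurd h hk⟩
    choose m hm using hm
    have hlarge : ∀ᶠ N : ℕ in atTop, ∀ k ∈ Finset.range B, m k ≤ c * ((N : ℝ) / K N) :=
      (Finset.eventually_all _).2 fun k _ =>
        ((tendsto_average_size hrate).const_mul_atTop hc).eventually_ge_atTop (m k)
    filter_upwards [hlarge, eventually_gt_atTop 0] with N hN hN0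
    refine (hunion N).trans ?_
    calc _ ≤ ∑ _k ∈ Finset.range (K N), η / (B + 1 : ℕ) := Finset.sum_le_sum fun k hk => by
          have hk' := Finset.mem_range.1 hk
          exact hm k ⟨N, hk'⟩ N ((hN k (Finset.mem_range.2 (hk'.trans_le (hB N)))).trans
            (hcard N hN0 k hk').2)
      _ = K N * (η / (B + 1 : ℕ)) := by simp
      _ ≤ (B + 1 : ℕ) * (η / (B + 1 : ℕ)) := by
          gcongr
          exact (hB N).trans (Nat.le_succ B)
      _ ≤ η := ENNReal.mul_div_le
  -- Chebyshev costs C / (nₖ ε²) per worker with nₖ ≥ cN / K; the sum over K workers is C / (c ε²) ·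
  -- K² / N.
  · have hlim : Tendsto (fun N : ℕ => ENNReal.ofReal (C / (c * ε ^ 2) *
        ((K N : ℝ) / √(N : ℝ)) ^ 2)) atTop (𝓝 0) := by
      have := ((tendsto_workers_div_sqrt hrate).pow 2).const_mul (C / (c * ε ^ 2))
      simpa using ENNReal.tendsto_ofReal this
    filter_upwards [hlim.eventually_le_const hη, eventually_gt_atTop 0] with N hN hN0
    refine (hunion N).trans (le_trans ?_ hN)
    have hNpos : (0 : ℝ) < N := by exact_mod_cast hN0
    have hKpos : (0 : ℝ) < K N := by exact_mod_cast hd.workers_pos hN0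
    calc _ ≤ ∑ _k ∈ Finset.range (K N), ENNReal.ofReal (C / (c * ((N : ℝ) / K N) * ε ^ 2)) := by
          refine Finset.sum_le_sum fun k hk => ?_
          have hk' := Finset.mem_range.1 hk
          have h1 := hC N k hk'
          have hCpos : 0 ≤ C := le_trans (integral_nonneg fun z => sq_nonneg _) h1.2
          refine (hS.measure_shardMean_sub_ge_le (hd.shard_card_pos hN0 hk') h1.1 h1.2 hε).trans
            (ENNReal.ofReal_le_ofReal ?_)
          have h2 := (hcard N hN0 k hk').2
          gcongr
      _ = ENNReal.ofReal (K N * (C / (c * ((N : ℝ) / K N) * ε ^ 2))) := by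
          rw [ENNReal.ofReal_mul hKpos.le]
          simp
      _ = _ := by
          congr 1
          rw [div_pow, Real.sq_sqrt hNpos.le]
          field_simp

/-! ### Stochastic order of centred sums -/

/-- Sums of centred observations are `O_p(√N)`. -/
theorem exists_measure_sum_gt_le [IsProbabilityMeasure P] [∀ k, IsProbabilityMeasure (μ k)]
    (hS : IsSample P μ w Z) (hd : IsBalancedDesign K w) {C : ℝ}
    (hf : ∀ N, ∀ k < K N, MemLp f 2 (μ k)) (hf0 : ∀ N, ∀ k < K N, ∫ z, f z ∂(μ k) = 0)
    (hC : ∀ N, ∀ k < K N, ∫ z, f z ^ 2 ∂(μ k) ≤ C) {ε : ENNReal} (hε : 0 < ε) :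
    ∃ D : ℝ, 0 < D ∧ ∀ᶠ N : ℕ in atTop,
      P {ω | D * √(N : ℝ) ≤ |∑ i ∈ Finset.range N, f (Z N i ω)|} ≤ ε := by
  obtain ⟨D, hD, hDε⟩ := exists_pos_ofReal_div_le C hε
  -- Squared, the threshold becomes D N, and Markov's inequality for the squared sum gives C / D.
  refine ⟨√D, Real.sqrt_pos.2 hD, ?_⟩
  filter_upwards [eventually_gt_atTop 0] with N hN
  have hNpos : (0 : ℝ) < N := by exact_mod_cast hN
  have hlt : ∀ i ∈ Finset.range N, i < N := fun i hi => Finset.mem_range.1 hi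
  have hw : ∀ i ∈ Finset.range N, w N i < K N := fun i hi => hd.worker_lt N i (hlt i hi)
  obtain ⟨hint, hle⟩ := hS.integral_sum_sq_le hlt (fun i hi => hf N _ (hw i hi))
    (fun i hi => hf0 N _ (hw i hi)) (fun i hi => hC N _ (hw i hi))
  have h1 := measure_ge_le_integral_div (P := P) (Eventually.of_forall fun ω => sq_nonneg _) hint
    (mul_pos hD hNpos)
  refine le_trans (measure_mono fun ω hω => ?_) (h1.trans
    ((ENNReal.ofReal_le_ofReal ?_).trans hDε))
  · simp only [Set.mem_ofPred_eq] at hω ⊢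
    have := pow_le_pow_left₀ (by positivity) hω 2
    rwa [mul_pow, Real.sq_sqrt hD.le, Real.sq_sqrt hNpos.le, sq_abs] at this
  · rw [Finset.card_range] at hle
    calc _ ≤ N * C / (D * N) := by gcongr
      _ = C / D := by field_simp

/-- The sum over the workers of `n_k` times the squared mean of centred observations is
`O_p(K)`, hence `O_p(√N)`. -/
theorem exists_measure_sum_card_mul_shardMean_sq_gt_le [IsProbabilityMeasure P]
    [∀ k, IsProbabilityMeasure (μ k)]
    (hS : IsSample P μ w Z)
    (hrate : Tendsto (fun N : ℕ => ((N : ℝ) / K N) / √(N : ℝ)) atTop atTop) {C : ℝ}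
    (hf : ∀ N, ∀ k < K N, MemLp f 2 (μ k)) (hf0 : ∀ N, ∀ k < K N, ∫ z, f z ∂(μ k) = 0)
    (hC : ∀ N, ∀ k < K N, ∫ z, f z ^ 2 ∂(μ k) ≤ C) (hC0 : 0 ≤ C) {ε : ENNReal} (hε : 0 < ε) :
    ∃ D : ℝ, 0 < D ∧ ∀ᶠ N : ℕ in atTop,
      P {ω | D * √(N : ℝ) ≤ ∑ k ∈ Finset.range (K N),
        ((shard w N k).card : ℝ) * shardMean f w Z N k ω ^ 2} ≤ ε := by
  obtain ⟨D, hD, hDε⟩ := exists_pos_ofReal_div_le C hε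
  refine ⟨D, hD, ?_⟩
  filter_upwards [eventually_gt_atTop 0,
    (tendsto_workers_div_sqrt hrate).eventually_le_const zero_lt_one] with N hN hKN
  have hNpos : (0 : ℝ) < N := by exact_mod_cast hN
  have hsqrt : 0 < √(N : ℝ) := Real.sqrt_pos.2 hNpos
  -- The squared shard sum has expectation at most nₖ C, so each weighted square has expectation at
  -- most nₖ · nₖ⁻² · nₖ C = C, whatever the shard size. For an empty shard the term is zero and
  -- `hC0` is needed.
  have hterm : ∀ k < K N,
      Integrable (fun ω => ((shard w N k).card : ℝ) * shardMean f w Z N k ω ^ 2) P ∧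
        ∫ ω, ((shard w N k).card : ℝ) * shardMean f w Z N k ω ^ 2 ∂P ≤ C := by
    intro k hk
    have hw : ∀ i ∈ shard w N k, w N i = k := fun i hi => (mem_shard.1 hi).2
    obtain ⟨hint, hle⟩ := hS.integral_sum_sq_le (f := f) (C := C) (s := shard w N k) (N := N)
      (fun i hi => (mem_shard.1 hi).1) (fun i hi => by rw [hw i hi]; exact hf N k hk)
      (fun i hi => by rw [hw i hi]; exact hf0 N k hk)
      (fun i hi => by rw [hw i hi]; exact hC N k hk)
    simp only [shardMean, mul_pow, ← mul_assoc]
    refine ⟨hint.const_mul _, ?_⟩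
    rw [integral_const_mul]
    rcases Nat.eq_zero_or_pos (shard w N k).card with h0 | h0
    · simpa [h0] using hC0
    · have h0' : (0 : ℝ) < (shard w N k).card := by exact_mod_cast h0
      calc _ ≤ ((shard w N k).card : ℝ) * ((shard w N k).card : ℝ)⁻¹ ^ 2 *
            ((shard w N k).card * C) := by gcongr
        _ = C := by field_simp
  have hint := integrable_finsetSum (Finset.range (K N))
    fun k hk => (hterm k (Finset.mem_range.1 hk)).1
  have h1 := measure_ge_le_integral_div (P := P) (Eventually.of_forall fun ω =>
    Finset.sum_nonneg fun k _ => mul_nonneg (Nat.cast_nonneg _) (sq_nonneg _)) hint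
    (mul_pos hD hsqrt)
  refine h1.trans ((ENNReal.ofReal_le_ofReal ?_).trans hDε)
  rw [integral_finsetSum _ fun k hk => (hterm k (Finset.mem_range.1 hk)).1]
  calc _ ≤ (K N * C) / (D * √(N : ℝ)) := by
        gcongr
        calc _ ≤ ∑ _k ∈ Finset.range (K N), C :=
              Finset.sum_le_sum fun k hk => (hterm k (Finset.mem_range.1 hk)).2
          _ = K N * C := by simp
    _ = (K N / √(N : ℝ)) * (C / D) := by field_simp
    _ ≤ 1 * (C / D) := by gcongr
    _ = C / D := one_mul _

end Sample

end DLSA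

namespace DLSA

variable {p : ℕ} {Ω 𝒵 : Type*} [MeasurableSpace Ω] [MeasurableSpace 𝒵] {P : Measure Ω}
  {μ : ℕ → Measure 𝒵} {Θ : Set (Par p)} {θ₀ : Par p} {ℒ : Par p → 𝒵 → ℝ} {K : ℕ → ℕ}
  {w : ℕ → ℕ → ℕ} {Z : ℕ → ℕ → Ω → 𝒵} {δ : ℝ} {M : Fin p → Fin p → Fin p → 𝒵 → ℝ} {N k : ℕ}

/-! ### Constants that do not depend on the worker -/

lemma quadForm_eq_dotProduct (A : Matrix (Fin p) (Fin p) ℝ) (v : Par p) :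
    quadForm A v = dotProduct (v : Fin p → ℝ) (A.mulVec v) := by
  rw [quadForm_eq_sum_mul]
  rfl

lemma quadForm_smul (A : Matrix (Fin p) (Fin p) ℝ) (t : ℝ) (v : Par p) :
    quadForm A (t • v) = t ^ 2 * quadForm A v := by
  simp only [quadForm, Finset.mul_sum, PiLp.smul_apply, smul_eq_mul]
  exact Finset.sum_congr rfl fun i _ => Finset.sum_congr rfl fun j _ => by ring

/-- By homogeneity the constant is the minimum over the compact unit sphere. In dimension zero the
sphere is empty and any constant works. -/
lemma exists_quadForm_lower_of_pos {A : Matrix (Fin p) (Fin p) ℝ}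
    (hA : ∀ v : Par p, v ≠ 0 → 0 < quadForm A v) :
    ∃ c : ℝ, 0 < c ∧ ∀ v : Par p, c * ‖v‖ ^ 2 ≤ quadForm A v := by
  rcases (Metric.sphere (0 : Par p) 1).eq_empty_or_nonempty with hempty | hne
  · refine ⟨1, one_pos, fun v => ?_⟩
    have hv : v = 0 := by
      by_contra hv
      have : (‖v‖⁻¹ • v) ∈ Metric.sphere (0 : Par p) 1 := by
        rw [mem_sphere_zero_iff_norm, norm_smul, norm_inv, norm_norm,
          inv_mul_cancel₀ (norm_ne_zero_iff.2 hv)]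
      simp [hempty] at this
    simp [hv, quadForm]
  · obtain ⟨x, hx, hmin⟩ := (isCompact_sphere (0 : Par p) 1).exists_isMinOn hne
      (continuous_quadForm A).continuousOn
    have hx0 : x ≠ 0 := by
      rintro rfl
      simp at hx
    refine ⟨quadForm A x, hA x hx0, fun v => ?_⟩
    by_cases hv : v = 0
    · simp [hv, quadForm]
    · have hmem : (‖v‖⁻¹ • v) ∈ Metric.sphere (0 : Par p) 1 := by
        rw [mem_sphere_zero_iff_norm, norm_smul, norm_inv, norm_norm,
          inv_mul_cancel₀ (norm_ne_zero_iff.2 hv)]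
      have h1 : quadForm A x ≤ quadForm A (‖v‖⁻¹ • v) := hmin hmem
      rw [quadForm_smul] at h1
      have h2 : 0 < ‖v‖ := norm_pos_iff.2 hv
      calc quadForm A x * ‖v‖ ^ 2 ≤ ‖v‖⁻¹ ^ 2 * quadForm A v * ‖v‖ ^ 2 := by gcongr
        _ = quadForm A v := by field_simp

lemma quadForm_eq_integral_sq {ν : Measure 𝒵} {s : Fin p → 𝒵 → ℝ}
    {A : Matrix (Fin p) (Fin p) ℝ} (hint : ∀ i j, Integrable (fun z => s i z * s j z) ν)
    (hA : ∀ i j, ∫ z, s i z * s j z ∂ν = A i j) (v : Par p) :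
    quadForm A v = ∫ z, (∑ i, v i * s i z) ^ 2 ∂ν := by
  have h1 : ∀ z, (∑ i, v i * s i z) ^ 2 = ∑ i, ∑ j, v i * v j * (s i z * s j z) := by
    intro z
    rw [sq, Finset.sum_mul_sum]
    exact Finset.sum_congr rfl fun i _ => Finset.sum_congr rfl fun j _ => by ring
  simp only [h1]
  rw [integral_finsetSum _ fun i _ => integrable_finsetSum _ fun j _ => (hint i j).const_mul _]
  refine Finset.sum_congr rfl fun i _ => ?_
  rw [integral_finsetSum _ fun j _ => (hint i j).const_mul _]
  refine Finset.sum_congr rfl fun j _ => ?_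
  rw [integral_const_mul, hA]
  ring

/-- By the information equality the form is the second moment of ⟨v, score⟩, hence positive
semidefinite; nonsingularity makes it definite. -/
lemma CondC4.exists_info_lower (hC4 : CondC4 μ θ₀ ℒ K) (hk : k < K N) :
    ∃ c : ℝ, 0 < c ∧ ∀ v : Par p, c * ‖v‖ ^ 2 ≤ quadForm (info (μ k) ℒ θ₀) v := by
  have hquad := quadForm_eq_integral_sq (hC4.score_integrable N k hk) (hC4.info_eq N k hk)
  have hsymm : (info (μ k) ℒ θ₀).IsHermitian := by
    ext i j
    simp only [Matrix.conjTranspose_apply, star_trivial]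
    rw [← hC4.info_eq N k hk, ← hC4.info_eq N k hk]
    simp only [mul_comm]
  have hpsd : (info (μ k) ℒ θ₀).PosSemidef := by
    refine Matrix.PosSemidef.of_dotProduct_mulVec_nonneg hsymm fun x => ?_
    have := quadForm_eq_dotProduct (info (μ k) ℒ θ₀) (WithLp.toLp 2 x)
    rw [star_trivial, ← this, hquad]
    exact integral_nonneg fun z => sq_nonneg _
  have hpd := hpsd.posDef_iff_det_ne_zero.2 (hC4.nonsingular N k hk).ne_zero
  refine exists_quadForm_lower_of_pos fun v hv => ?_
  rw [quadForm_eq_dotProduct]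
  have := hpd.dotProduct_mulVec_pos (x := (v : Fin p → ℝ)) (by simpa using hv)
  simpa using this

lemma abs_integral_le_integral_sq_add_one {ν : Measure 𝒵} [IsProbabilityMeasure ν] {f : 𝒵 → ℝ}
    (hf : MemLp f 2 ν) : |∫ z, f z ∂ν| ≤ ∫ z, f z ^ 2 ∂ν + 1 := by
  have h1 : ∫ z, (f z ^ 2 + 1) ∂ν = ∫ z, f z ^ 2 ∂ν + 1 := by
    rw [integral_add hf.integrable_sq (integrable_const _)]
    simp
  rw [← h1]
  refine abs_integral_le_integral_abs.trans (integral_mono (hf.integrable (by norm_num)).abs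
    (hf.integrable_sq.add (integrable_const _)) fun z => ?_)
  have := sq_nonneg (|f z| - 1)
  have h2 := sq_abs (f z)
  have h3 := abs_nonneg (f z)
  simp only
  nlinarith

/-- Lower bounds of the information matrices and upper bounds of their entries and of the
expected bounds on the third derivatives, uniform over the workers. -/
lemma exists_uniform_constants [∀ k, IsProbabilityMeasure (μ k)] (hC4 : CondC4 μ θ₀ ℒ K)
    (hK : (∃ B : ℕ, ∀ N, K N ≤ B) ∨ UniformOverWorkers μ θ₀ ℒ K M) :
    ∃ c C : ℝ, 0 < c ∧ 0 ≤ C ∧ ∀ N, ∀ k < K N,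
      (∀ v : Par p, c * ‖v‖ ^ 2 ≤ quadForm (info (μ k) ℒ θ₀) v) ∧
      (∀ i j, |info (μ k) ℒ θ₀ i j| ≤ C) ∧ ∀ i j l, ∫ z, M i j l z ∂(μ k) ≤ C := by
  rcases hK with ⟨B, hB⟩ | ⟨c, C, hc, h⟩
  · have hm : ∀ k, ∃ c : ℝ, 0 < c ∧ ((∃ N, k < K N) →
        ∀ v : Par p, c * ‖v‖ ^ 2 ≤ quadForm (info (μ k) ℒ θ₀) v) := by
      intro k
      by_cases hk : ∃ N, k < K N
      · obtain ⟨N, hN⟩ := hk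
        obtain ⟨c, hc, hv⟩ := hC4.exists_info_lower hN
        exact ⟨c, hc, fun _ => hv⟩
      · exact ⟨1, one_pos, fun h => absurd h hk⟩
    choose m hm0 hm using hm
    -- With finitely many workers, every small enough positive `c` and every large enough `C` will
    -- do.
    obtain ⟨c, hc, hc0⟩ := (((Finset.eventually_all (Finset.range B)).2 fun k _ =>
      Ioc_mem_nhdsGT (hm0 k)).and (self_mem_nhdsWithin (a := (0 : ℝ)) (s := Set.Ioi 0))).exists
    obtain ⟨C, hCi, hCM, hC0⟩ := (((Finset.eventually_all (Finset.range B)).2 fun k _ =>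
      eventually_all.2 fun i : Fin p => eventually_all.2 fun j : Fin p =>
        eventually_ge_atTop |info (μ k) ℒ θ₀ i j|).and
      (((Finset.eventually_all (Finset.range B)).2 fun k _ =>
        eventually_all.2 fun i : Fin p => eventually_all.2 fun j : Fin p =>
          eventually_all.2 fun l : Fin p => eventually_ge_atTop (∫ z, M i j l z ∂(μ k))).and
        (eventually_ge_atTop (0 : ℝ)))).exists
    refine ⟨c, C, hc0, hC0, fun N k hk => ?_⟩
    have hkB : k ∈ Finset.range B := Finset.mem_range.2 (hk.trans_le (hB N))
    refine ⟨fun v => (mul_le_mul_of_nonneg_right (hc k hkB).2 (sq_nonneg _)).trans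
      (hm k ⟨N, hk⟩ v), hCi k hkB, hCM k hkB⟩
  · refine ⟨c, |C| + 1, hc, by positivity, fun N k hk => ?_⟩
    obtain ⟨h1, h2, h3⟩ := h N k hk
    refine ⟨h1, fun i j => ?_, fun i j l => ?_⟩
    · refine (abs_integral_le_integral_sq_add_one (h2 i j).1).trans ?_
      linarith [(h2 i j).2, le_abs_self C]
    · refine (le_abs_self _).trans ((abs_integral_le_integral_sq_add_one (h3 i j l).1).trans ?_)
      linarith [(h3 i j l).2, le_abs_self C]

lemma hasMomentBounds_hess (hC4 : CondC4 μ θ₀ ℒ K)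
    (hK : (∃ B : ℕ, ∀ N, K N ≤ B) ∨ UniformOverWorkers μ θ₀ ℒ K M) (i j : Fin p) :
    HasMomentBounds (fun z => hess (fun θ => ℒ θ z) θ₀ i j) μ K := by
  rcases hK with hB | ⟨c, C, -, h⟩
  · exact Or.inl ⟨hB, fun N k hk => hC4.hess_integrable N k hk i j⟩
  · exact Or.inr ⟨C, fun N k hk => (h N k hk).2.1 i j⟩

lemma hasMomentBounds_third (hC5 : CondC5 μ Θ θ₀ ℒ K δ M)
    (hK : (∃ B : ℕ, ∀ N, K N ≤ B) ∨ UniformOverWorkers μ θ₀ ℒ K M) (i j l : Fin p) :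
    HasMomentBounds (M i j l) μ K := by
  rcases hK with hB | ⟨c, C, -, h⟩
  · exact Or.inl ⟨hB, fun N k hk => hC5.integrable N k hk i j l⟩
  · exact Or.inr ⟨C, fun N k hk => (h N k hk).2.2 i j l⟩

lemma memLp_score (hC3 : CondC3 P μ Θ θ₀ ℒ K w Z) (hC4 : CondC4 μ θ₀ ℒ K) (hk : k < K N)
    (i : Fin p) : MemLp (fun z => pderiv i (fun θ => ℒ θ z) θ₀) 2 (μ k) := by
  rw [memLp_two_iff_integrable_sq (hC3.score_integrable N k hk i).1]
  simpa only [sq] using hC4.score_integrable N k hk i i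

/-- The information equality turns control of the expected Hessian into control of the score
variance. -/
lemma integral_score_sq_le (hC4 : CondC4 μ θ₀ ℒ K) {C : ℝ} (hk : k < K N)
    (hC : ∀ i j, |info (μ k) ℒ θ₀ i j| ≤ C) (i : Fin p) :
    ∫ z, pderiv i (fun θ => ℒ θ z) θ₀ ^ 2 ∂(μ k) ≤ C := by
  simp only [sq]
  rw [hC4.info_eq N k hk i i]
  exact (le_abs_self _).trans (hC i i)

/-! ### A single worker -/

omit [MeasurableSpace 𝒵] in
lemma IsLocalEstimator.forall_ae {thetaHat : ℕ → ℕ → Ω → Par p}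
    (hhat : IsLocalEstimator P Θ ℒ K w Z thetaHat) (N : ℕ) :
    ∀ᵐ ω ∂P, ∀ k < K N, thetaHat N k ω ∈ Θ ∧
      IsMinOn (localLoss ℒ w Z N k ω) Θ (thetaHat N k ω) :=
  ae_all_iff.2 fun k => by
    by_cases hk : k < K N
    · filter_upwards [hhat N k hk] with ω hω _ using hω
    · exact Eventually.of_forall fun ω h => absurd h hk

/-- All local estimators are close to `θ₀`, with probability tending to one. -/
lemma probTendstoOne_local_consistent (hC1 : CondC1 Θ θ₀) (hC3 : CondC3 P μ Θ θ₀ ℒ K w Z)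
    {thetaHat : ℕ → ℕ → Ω → Par p}
    (hhat : IsLocalEstimator P Θ ℒ K w Z thetaHat) {r : ℝ} (hr : 0 < r) :
    ProbTendstoOne P fun N => {ω | ∀ k < K N, ‖thetaHat N k ω - θ₀‖ ≤ r} := by
  obtain ⟨ε, hε, h⟩ := hC3.separated r hr
  refine (h.inter (ProbTendstoOne.of_ae hhat.forall_ae)).mono (Eventually.of_forall ?_)
  rintro N ω ⟨h1, h2⟩ k hk
  by_contra! hcon
  have h3 := h1 k hk _ (h2 k hk).1 hcon.le
  have h4 : localLoss ℒ w Z N k ω (thetaHat N k ω) ≤ localLoss ℒ w Z N k ω θ₀ :=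
    (h2 k hk).2 (interior_subset hC1.interior)
  linarith

/-- The third derivative bounds hold for all observations. -/
lemma CondC5.forall_ae (hC5 : CondC5 μ Θ θ₀ ℒ K δ M) (hS : IsSample P μ w Z)
    (hd : IsBalancedDesign K w) (N : ℕ) :
    ∀ᵐ ω ∂P, ∀ i < N, ∀ θ ∈ Θ, ‖θ - θ₀‖ ≤ δ → ∀ a b c,
      HasPartial a (pderiv b (pderiv c fun η => ℒ η (Z N i ω))) θ ∧
        |pderiv a (pderiv b (pderiv c fun η => ℒ η (Z N i ω))) θ| ≤ M a b c (Z N i ω) :=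
  ae_all_iff.2 fun i => by
    by_cases hi : i < N
    · filter_upwards [hS.ae_comp hi (hC5.third N _ (hd.worker_lt N i hi))] with ω hω _ using hω
    · exact Eventually.of_forall fun ω h => absurd h hi

section Worker

variable {ω : Ω}

omit [MeasurableSpace Ω] [MeasurableSpace 𝒵]

lemma twiceDifferentiableOn_localLoss
    (hℒ : ∀ z, TwiceDifferentiableOn (fun θ => ℒ θ z) (interior Θ)) :
    TwiceDifferentiableOn (localLoss ℒ w Z N k ω) (interior Θ) :=
  TwiceDifferentiableOn.average _ _ isOpen_interior fun _ _ => hℒ _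

lemma hess_localLoss (hℒ : ∀ z, TwiceDifferentiableOn (fun θ => ℒ θ z) (interior Θ))
    {θ : Par p} (hθ : θ ∈ interior Θ) (i j : Fin p) :
    hess (localLoss ℒ w Z N k ω) θ i j =
      shardMean (fun z => hess (fun η => ℒ η z) θ i j) w Z N k ω :=
  hess_average _ _ isOpen_interior (fun _ _ => hℒ _) hθ i j

lemma pderiv_localLoss (hℒ : ∀ z, TwiceDifferentiableOn (fun θ => ℒ θ z) (interior Θ))
    {θ : Par p} (hθ : θ ∈ interior Θ) (i : Fin p) :
    pderiv i (localLoss ℒ w Z N k ω) θ =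
      shardMean (fun z => pderiv i (fun η => ℒ η z) θ) w Z N k ω :=
  pderiv_average _ _ (fun _ _ => (hℒ _ θ hθ).1) i

/-- The Hessian of the local loss is Lipschitz at `θ₀`. -/
lemma abs_hess_localLoss_sub_le
    (hℒ : ∀ z, TwiceDifferentiableOn (fun θ => ℒ θ z) (interior Θ)) {r C : ℝ} (hrδ : r ≤ δ)
    (hball : ∀ η, ‖η - θ₀‖ ≤ r → η ∈ interior Θ)
    (hthird : ∀ i < N, ∀ θ ∈ Θ, ‖θ - θ₀‖ ≤ δ → ∀ a b c,
      HasPartial a (pderiv b (pderiv c fun η => ℒ η (Z N i ω))) θ ∧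
        |pderiv a (pderiv b (pderiv c fun η => ℒ η (Z N i ω))) θ| ≤ M a b c (Z N i ω))
    (hM : ∀ a b c, shardMean (M a b c) w Z N k ω ≤ C)
    {θ : Par p} (hθ : ‖θ - θ₀‖ ≤ r) (i j : Fin p) :
    |hess (localLoss ℒ w Z N k ω) θ i j - hess (localLoss ℒ w Z N k ω) θ₀ i j| ≤
      p * C * ‖θ - θ₀‖ := by
  have hr : 0 ≤ r := (norm_nonneg _).trans hθ
  have hθ₀ : θ₀ ∈ interior Θ := hball _ (by simpa using hr)
  have hinv : (0 : ℝ) ≤ ((shard w N k).card : ℝ)⁻¹ := by positivity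
  rw [hess_localLoss hℒ (hball θ hθ), hess_localLoss hℒ hθ₀]
  simp only [shardMean]
  rw [← mul_sub, ← Finset.sum_sub_distrib, abs_mul, abs_of_nonneg hinv]
  calc _ ≤ ((shard w N k).card : ℝ)⁻¹ * ∑ m ∈ shard w N k,
        ∑ a, M a i j (Z N m ω) * |θ a - θ₀ a| := by
        refine mul_le_mul_of_nonneg_left ((Finset.abs_sum_le_sum_abs _ _).trans
          (Finset.sum_le_sum fun m hm => ?_)) hinv
        exact abs_sub_le_of_partial_bound (g := pderiv i (pderiv j fun η => ℒ η (Z N m ω)))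
          (fun η hη a => hthird m (mem_shard.1 hm).1 η (interior_subset (hball η hη))
            (hη.trans hrδ) a i j) hθ
    _ = ∑ a, shardMean (M a i j) w Z N k ω * |θ a - θ₀ a| := by
        rw [Finset.sum_comm]
        simp only [shardMean, Finset.mul_sum, Finset.sum_mul, mul_assoc]
    _ ≤ ∑ _a : Fin p, C * ‖θ - θ₀‖ := Finset.sum_le_sum fun a _ => by
        -- The functions `M` dominate absolute values at `θ₀`, so their shard means are nonnegative.
        have hC : 0 ≤ C := by
          refine le_trans (mul_nonneg hinv (Finset.sum_nonneg fun m hm => ?_)) (hM a i j)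
          exact (abs_nonneg _).trans (hthird m (mem_shard.1 hm).1 θ₀ (interior_subset hθ₀)
            (by simpa using hr.trans hrδ) a i j).2
        exact mul_le_mul (hM a i j) (by simpa using abs_coord_le (θ - θ₀) a) (abs_nonneg _) hC
    _ = p * C * ‖θ - θ₀‖ := by simp [mul_assoc]

end Worker

end DLSA

namespace DLSA

variable {p : ℕ} {Ω 𝒵 : Type*} [MeasurableSpace Ω] [MeasurableSpace 𝒵] {P : Measure Ω}
  {μ : ℕ → Measure 𝒵} {Θ : Set (Par p)} {θ₀ : Par p} {ℒ : Par p → 𝒵 → ℝ} {K : ℕ → ℕ}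
  {w : ℕ → ℕ → ℕ} {Z : ℕ → ℕ → Ω → 𝒵} {δ : ℝ} {M : Fin p → Fin p → Fin p → 𝒵 → ℝ} {N k : ℕ}
  {ω : Ω}

omit [MeasurableSpace Ω] [MeasurableSpace 𝒵] in
/-- The Hessian of the local loss at the local estimator, and the linear expansion of the local
estimator, on outcomes for which the local Hessian and third derivatives are under control. -/
lemma local_expansion (hℒ : ∀ z, TwiceDifferentiableOn (fun θ => ℒ θ z) (interior Θ))
    {r C c ε : ℝ} (hrδ : r ≤ δ) (hball : ∀ η, ‖η - θ₀‖ ≤ r → η ∈ interior Θ)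
    (hthird : ∀ i < N, ∀ θ ∈ Θ, ‖θ - θ₀‖ ≤ δ → ∀ a b c,
      HasPartial a (pderiv b (pderiv c fun η => ℒ η (Z N i ω))) θ ∧
        |pderiv a (pderiv b (pderiv c fun η => ℒ η (Z N i ω))) θ| ≤ M a b c (Z N i ω))
    (hM : ∀ a b c, shardMean (M a b c) w Z N k ω ≤ C) (hC : 0 ≤ C) (hc : 0 < c)
    {I : Matrix (Fin p) (Fin p) ℝ} (hI : ∀ v, c * ‖v‖ ^ 2 ≤ quadForm I v)
    (hH : ∀ i j, |shardMean (fun z => hess (fun η => ℒ η z) θ₀ i j) w Z N k ω - I i j| ≤ ε)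
    (hsmall : (p : ℝ) ^ 2 * (ε + p * C * r) ≤ c / 2)
    {θ : Par p} (hθ : ‖θ - θ₀‖ ≤ r) (hmin : IsMinOn (localLoss ℒ w Z N k ω) Θ θ) :
    (∀ v, c / 2 * ‖v‖ ^ 2 ≤ quadForm (hess (localLoss ℒ w Z N k ω) θ) v) ∧
    (∀ i j, |hess (localLoss ℒ w Z N k ω) θ i j - I i j| ≤ ε + p * C * r) ∧
    ∀ i, |∑ j, hess (localLoss ℒ w Z N k ω) θ i j * (θ - θ₀) j +
        shardMean (fun z => pderiv i (fun η => ℒ η z) θ₀) w Z N k ω| ≤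
      2 * p * (p * C) * (2 * p / c) ^ 2 *
        ∑ j, shardMean (fun z => pderiv j (fun η => ℒ η z) θ₀) w Z N k ω ^ 2 := by
  set F := localLoss ℒ w Z N k ω with hF
  have hr : 0 ≤ r := (norm_nonneg _).trans hθ
  have hθ₀ : θ₀ ∈ interior Θ := hball _ (by simpa using hr)
  have htd : TwiceDifferentiableOn F (interior Θ) := twiceDifferentiableOn_localLoss hℒ
  have hlip : ∀ η, ‖η - θ₀‖ ≤ r → ∀ i j,
      |hess F η i j - hess F θ₀ i j| ≤ p * C * ‖η - θ₀‖ :=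
    fun η hη => abs_hess_localLoss_sub_le hℒ hrδ hball hthird hM hη
  have hL : 0 ≤ (p : ℝ) * C := by positivity
  have hentry : ∀ η, ‖η - θ₀‖ ≤ r → ∀ i j, |hess F η i j - I i j| ≤ ε + p * C * r := by
    intro η hη i j
    have h1 := hlip η hη i j
    have h2 := hH i j
    rw [← hess_localLoss hℒ hθ₀] at h2
    have h3 := abs_sub_le (hess F η i j) (hess F θ₀ i j) (I i j)
    have h4 := mul_le_mul_of_nonneg_left hη hL
    linarith
  have hquad : ∀ η, ‖η - θ₀‖ ≤ r → ∀ v, c / 2 * ‖v‖ ^ 2 ≤ quadForm (hess F η) v := by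
    intro η hη v
    refine le_trans ?_ (quadForm_lower (hentry η hη) hI v)
    gcongr
    linarith
  have hstat : ∀ i, pderiv i F θ = 0 :=
    pderiv_eq_zero_of_isMinOn hmin (hball θ hθ) (htd θ (hball θ hθ)).1
  refine ⟨hquad θ hθ, hentry θ hθ, fun i => ?_⟩
  simp only [← pderiv_localLoss hℒ hθ₀, ← hF]
  -- √W bounds every component of the score, so ‖θ - θ₀‖ ≤ (2p / c)√W and the quadratic remainder
  -- becomes linear in W. In this form it can be summed over the workers and integrated.
  set W := ∑ j, pderiv j F θ₀ ^ 2 with hW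
  have hG : ∀ j, |pderiv j F θ₀| ≤ √W := fun j =>
    Real.abs_le_sqrt (Finset.single_le_sum (f := fun j => pderiv j F θ₀ ^ 2)
      (fun _ _ => sq_nonneg _) (Finset.mem_univ j))
  have hW0 : 0 ≤ W := Finset.sum_nonneg fun _ _ => sq_nonneg _
  have h1 := norm_sub_le_of_stationary htd isOpen_interior hball hquad hθ hstat hG
  have h2 : ‖θ - θ₀‖ ≤ 2 * p / c * √W := by
    rw [div_mul_eq_mul_div, le_div_iff₀ hc]
    linarith
  have h3 : ‖θ - θ₀‖ ^ 2 ≤ (2 * p / c) ^ 2 * W := by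
    have := pow_le_pow_left₀ (norm_nonneg _) h2 2
    rwa [mul_pow, Real.sq_sqrt hW0] at this
  refine (abs_hess_mul_add_le htd isOpen_interior hball hL hlip hθ hstat i).trans ?_
  calc 2 * p * (p * C) * ‖θ - θ₀‖ ^ 2 ≤ 2 * p * (p * C) * ((2 * p / c) ^ 2 * W) := by gcongr
    _ = _ := by ring

/-! ### The distributed least squares loss -/

/-- The quadratic expansion of the distributed least squares loss around `θ₀`: the second order
coefficients are bounded below by `c` and above by `D`, the first order coefficients by `B`. -/
def HasQuadExpansion (q : Par p → ℝ) (θ₀ : Par p) (c D B : ℝ) : Prop :=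
  ∃ (q₀ : ℝ) (A : Matrix (Fin p) (Fin p) ℝ) (b : Fin p → ℝ),
    (∀ u, q (θ₀ + u) = q₀ + quadForm A u - 2 * ∑ i, b i * u i) ∧
    (∀ v, c * ‖v‖ ^ 2 ≤ quadForm A v) ∧ (∀ i j, |A i j| ≤ D) ∧ ∀ i, |b i| ≤ B

lemma sum_shard_card (hd : IsBalancedDesign K w) (N : ℕ) :
    ∑ k ∈ Finset.range (K N), ((shard w N k).card : ℝ) = N := by
  simpa using sum_shard_eq_sum_range hd N (fun _ => (1 : ℝ))

omit [MeasurableSpace Ω] [MeasurableSpace 𝒵] in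
lemma card_mul_shardMean (f : 𝒵 → ℝ) (h : 0 < (shard w N k).card) :
    ((shard w N k).card : ℝ) * shardMean f w Z N k ω = ∑ i ∈ shard w N k, f (Z N i ω) := by
  have h' : ((shard w N k).card : ℝ) ≠ 0 := by exact_mod_cast h.ne'
  rw [shardMean, ← mul_assoc, mul_inv_cancel₀ h', one_mul]

omit [MeasurableSpace Ω] [MeasurableSpace 𝒵] in
/-- Aggregation of the local expansions. -/
lemma hasQuadExpansion_dlsaLoss
    (hℒ : ∀ z, TwiceDifferentiableOn (fun θ => ℒ θ z) (interior Θ))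
    (hd : IsBalancedDesign K w) (hN : 0 < N) {thetaHat : ℕ → ℕ → Ω → Par p} {c D E T V : ℝ}
    (hE : 0 ≤ E)
    (hint : ∀ k < K N, thetaHat N k ω ∈ interior Θ)
    (hlow : ∀ k < K N, ∀ v,
      c * ‖v‖ ^ 2 ≤ quadForm (hess (localLoss ℒ w Z N k ω) (thetaHat N k ω)) v)
    (hup : ∀ k < K N, ∀ i j, |hess (localLoss ℒ w Z N k ω) (thetaHat N k ω) i j| ≤ D)
    (hexp : ∀ k < K N, ∀ i,
      |∑ j, hess (localLoss ℒ w Z N k ω) (thetaHat N k ω) i j * (thetaHat N k ω - θ₀) j +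
        shardMean (fun z => pderiv i (fun η => ℒ η z) θ₀) w Z N k ω| ≤
      E * ∑ j, shardMean (fun z => pderiv j (fun η => ℒ η z) θ₀) w Z N k ω ^ 2)
    (hT : ∀ i, |∑ m ∈ Finset.range N, pderiv i (fun η => ℒ η (Z N m ω)) θ₀| ≤ T)
    (hV : ∀ i, ∑ k ∈ Finset.range (K N), ((shard w N k).card : ℝ) *
      shardMean (fun z => pderiv i (fun η => ℒ η z) θ₀) w Z N k ω ^ 2 ≤ V) :
    HasQuadExpansion (dlsaLoss ℒ K w Z thetaHat N ω) θ₀ c D ((N : ℝ)⁻¹ * (T + E * (p * V))) := by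
  have hNpos : (0 : ℝ) < N := by exact_mod_cast hN
  set H : ℕ → Matrix (Fin p) (Fin p) ℝ := fun k =>
    ∑ i ∈ shard w N k, hess (fun η => ℒ η (Z N i ω)) (thetaHat N k ω) with hHdef
  have hcard : ∀ k < K N, 0 < (shard w N k).card := fun k hk => hd.shard_card_pos hN hk
  have hH : ∀ k < K N, ∀ i j,
      H k i j = (shard w N k).card * hess (localLoss ℒ w Z N k ω) (thetaHat N k ω) i j := by
    intro k hk i j
    rw [hess_localLoss hℒ (hint k hk), card_mul_shardMean _ (hcard k hk)]
    simp only [hHdef, Matrix.sum_apply]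
  have hHq : ∀ k < K N, ∀ v, quadForm (H k) v =
      (shard w N k).card * quadForm (hess (localLoss ℒ w Z N k ω) (thetaHat N k ω)) v := by
    intro k hk v
    simp only [quadForm, hH k hk, Finset.mul_sum]
    exact Finset.sum_congr rfl fun i _ => Finset.sum_congr rfl fun j _ => by ring
  have hsum := sum_shard_card hd N
  have hsymm : ∀ k ∈ Finset.range (K N), ∀ i j, H k i j = H k j i := by
    intro k hk i j
    have hk' := Finset.mem_range.1 hk
    rw [hH k hk', hH k hk', (twiceDifferentiableOn_localLoss hℒ).hess_symm isOpen_interior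
      (hint k hk')]
  -- The constant and the linear coefficients are read off from the expansion by unification; b i =
  -- N⁻¹ ∑ₖ ∑ⱼ Hₖ i j (θ̂ₖ - θ₀) j.
  refine ⟨_, (N : ℝ)⁻¹ • ∑ k ∈ Finset.range (K N), H k, _, fun u =>
    sum_quadForm_expand (Finset.range (K N)) (N : ℝ)⁻¹ H hsymm (fun k => thetaHat N k ω) θ₀ u,
    fun v => ?_, fun i j => ?_, fun i => ?_⟩
  · rw [quadForm_sum]
    calc c * ‖v‖ ^ 2 = (N : ℝ)⁻¹ * ∑ k ∈ Finset.range (K N),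
          ((shard w N k).card : ℝ) * (c * ‖v‖ ^ 2) := by
          rw [← Finset.sum_mul, hsum, ← mul_assoc, inv_mul_cancel₀ hNpos.ne', one_mul]
      _ ≤ _ := by
          refine mul_le_mul_of_nonneg_left (Finset.sum_le_sum fun k hk => ?_) (by positivity)
          have hk' := Finset.mem_range.1 hk
          rw [hHq k hk']
          exact mul_le_mul_of_nonneg_left (hlow k hk' v) (Nat.cast_nonneg _)
  · rw [Matrix.smul_apply, Matrix.sum_apply, smul_eq_mul, abs_mul, abs_of_pos (inv_pos.2 hNpos)]
    calc _ ≤ (N : ℝ)⁻¹ * ∑ k ∈ Finset.range (K N), ((shard w N k).card : ℝ) * D := by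
          refine mul_le_mul_of_nonneg_left ((Finset.abs_sum_le_sum_abs _ _).trans
            (Finset.sum_le_sum fun k hk => ?_)) (by positivity)
          have hk' := Finset.mem_range.1 hk
          rw [hH k hk', abs_mul, Nat.abs_cast]
          exact mul_le_mul_of_nonneg_left (hup k hk' i j) (Nat.cast_nonneg _)
      _ = D := by
          rw [← Finset.sum_mul, hsum, ← mul_assoc, inv_mul_cancel₀ hNpos.ne', one_mul]
  · rw [abs_mul, abs_of_pos (inv_pos.2 hNpos)]
    refine mul_le_mul_of_nonneg_left ?_ (inv_pos.2 hNpos).le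
    set S : ℕ → Fin p → ℝ := fun k i =>
      shardMean (fun z => pderiv i (fun η => ℒ η z) θ₀) w Z N k ω with hS
    -- The weights nₖ turn the shard means back into sums, so the leading terms recombine into the
    -- score of the full sample.
    have hscore : ∑ k ∈ Finset.range (K N), ((shard w N k).card : ℝ) * S k i =
        ∑ m ∈ Finset.range N, pderiv i (fun η => ℒ η (Z N m ω)) θ₀ := by
      refine Eq.trans ?_ (sum_shard_eq_sum_range hd N _)
      exact Finset.sum_congr rfl fun k hk =>
        card_mul_shardMean (fun z => pderiv i (fun η => ℒ η z) θ₀)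
          (hcard k (Finset.mem_range.1 hk))
    have hrem : |∑ k ∈ Finset.range (K N), ∑ j, H k i j * (thetaHat N k ω - θ₀) j +
        ∑ k ∈ Finset.range (K N), ((shard w N k).card : ℝ) * S k i| ≤ E * (p * V) := by
      rw [← Finset.sum_add_distrib]
      calc _ ≤ ∑ k ∈ Finset.range (K N),
            ((shard w N k).card : ℝ) * (E * ∑ j, S k j ^ 2) := by
            refine (Finset.abs_sum_le_sum_abs _ _).trans (Finset.sum_le_sum fun k hk => ?_)
            have hk' := Finset.mem_range.1 hk
            have h1 : ∑ j, H k i j * (thetaHat N k ω - θ₀) j + (shard w N k).card * S k i =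
                (shard w N k).card * (∑ j, hess (localLoss ℒ w Z N k ω) (thetaHat N k ω) i j *
                  (thetaHat N k ω - θ₀) j + S k i) := by
              rw [mul_add, Finset.mul_sum]
              congr 1
              exact Finset.sum_congr rfl fun j _ => by rw [hH k hk']; ring
            rw [h1, abs_mul, Nat.abs_cast]
            exact mul_le_mul_of_nonneg_left (hexp k hk' i) (Nat.cast_nonneg _)
        _ = E * ∑ j, ∑ k ∈ Finset.range (K N), ((shard w N k).card : ℝ) * S k j ^ 2 := by
            rw [Finset.sum_comm, Finset.mul_sum]
            refine Finset.sum_congr rfl fun k _ => ?_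
            rw [← Finset.mul_sum]
            ring
        _ ≤ E * ∑ _j : Fin p, V :=
            mul_le_mul_of_nonneg_left (Finset.sum_le_sum fun j _ => hV j) hE
        _ = E * (p * V) := by simp
    rw [hscore] at hrem
    have h2 := abs_sub_abs_le_abs_sub
      (∑ k ∈ Finset.range (K N), ∑ j, H k i j * (thetaHat N k ω - θ₀) j)
      (-∑ m ∈ Finset.range N, pderiv i (fun η => ℒ η (Z N m ω)) θ₀)
    rw [sub_neg_eq_add, abs_neg] at h2
    linarith [hT i]

/-- With probability arbitrarily close to one, the distributed least squares loss has a quadratic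
expansion around `θ₀` with nondegenerate second and `O(N^{-1/2})` first order coefficients. -/
theorem exists_hasQuadExpansion [IsProbabilityMeasure P] [∀ k, IsProbabilityMeasure (μ k)]
    (hℒ : ∀ z, TwiceDifferentiableOn (fun θ => ℒ θ z) (interior Θ))
    (hd : IsBalancedDesign K w)
    (hrate : Tendsto (fun N : ℕ => ((N : ℝ) / K N) / √(N : ℝ)) atTop atTop)
    (hC1 : CondC1 Θ θ₀) (hS : IsSample P μ w Z) (hC3 : CondC3 P μ Θ θ₀ ℒ K w Z)
    (hC4 : CondC4 μ θ₀ ℒ K) (hC5 : CondC5 μ Θ θ₀ ℒ K δ M)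
    (hK : (∃ B : ℕ, ∀ N, K N ≤ B) ∨ UniformOverWorkers μ θ₀ ℒ K M)
    {thetaHat : ℕ → ℕ → Ω → Par p} (hhat : IsLocalEstimator P Θ ℒ K w Z thetaHat) :
    ∃ c D : ℝ, 0 < c ∧ ∀ ε : ENNReal, 0 < ε → ∃ B : ℝ, 0 ≤ B ∧ ∀ᶠ N : ℕ in atTop,
      P {ω | HasQuadExpansion (dlsaLoss ℒ K w Z thetaHat N ω) θ₀ c D (B / √(N : ℝ))}ᶜ ≤ ε := by
  obtain ⟨c, C₀, hc, hC₀, hconst⟩ := exists_uniform_constants (M := M) hC4 hK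
  -- The extra 1 is the tolerance in the law of large numbers for the third derivative bounds.
  set C := C₀ + 1 with hCdef
  have hC : 0 < C := by positivity
  obtain ⟨ρ, hρ, hρball⟩ := Metric.isOpen_iff.1 isOpen_interior θ₀ hC1.interior
  -- The radius keeps the ball inside the smoothness region and the interior of `Θ`. Its last entry
  -- and the choice of `ε₁` each use at most c / 4 of the lower bound `c` on the information, which
  -- leaves c / 2 for the Hessians.
  set r := min (min δ (ρ / 2)) (c / (4 * ((p : ℝ) ^ 2 * (p * C) + 1))) with hrdef
  have hr : 0 < r := lt_min (lt_min hC5.pos (by positivity)) (by positivity)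
  have hrδ : r ≤ δ := (min_le_left _ _).trans (min_le_left _ _)
  have hball : ∀ η, ‖η - θ₀‖ ≤ r → η ∈ interior Θ := fun η hη => hρball (by
    rw [Metric.mem_ball, dist_eq_norm]
    have : r ≤ ρ / 2 := (min_le_left _ _).trans (min_le_right _ _)
    linarith)
  set ε₁ := c / (4 * ((p : ℝ) ^ 2 + 1)) with hε₁def
  have hε₁ : 0 < ε₁ := by positivity
  have hsmall : (p : ℝ) ^ 2 * (ε₁ + p * C * r) ≤ c / 2 := by
    have h1 : (p : ℝ) ^ 2 * ε₁ ≤ c / 4 := by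
      rw [hε₁def, mul_div_assoc', div_le_div_iff₀ (by positivity) (by norm_num)]
      nlinarith
    have h2 : (p : ℝ) ^ 2 * (p * C) * r ≤ c / 4 := by
      have h3 : r ≤ c / (4 * ((p : ℝ) ^ 2 * (p * C) + 1)) := min_le_right _ _
      have h5 : 0 ≤ (p : ℝ) ^ 2 * (p * C) := by positivity
      refine (mul_le_mul_of_nonneg_left h3 h5).trans ?_
      rw [mul_div_assoc', div_le_div_iff₀ (by positivity) (by norm_num)]
      nlinarith
    linarith
  set D := C + (ε₁ + p * C * r) with hDdef
  set E := 2 * p * (p * C) * (2 * p / c) ^ 2 with hEdef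
  have hE : 0 ≤ E := by positivity
  have hgood : ProbTendstoOne P fun N =>
      ({ω | ∀ k < K N, thetaHat N k ω ∈ Θ ∧
          IsMinOn (localLoss ℒ w Z N k ω) Θ (thetaHat N k ω)} ∩
        {ω | ∀ i < N, ∀ θ ∈ Θ, ‖θ - θ₀‖ ≤ δ → ∀ a b c,
          HasPartial a (pderiv b (pderiv c fun η => ℒ η (Z N i ω))) θ ∧
            |pderiv a (pderiv b (pderiv c fun η => ℒ η (Z N i ω))) θ| ≤ M a b c (Z N i ω)}) ∩
      ({ω | ∀ k < K N, ‖thetaHat N k ω - θ₀‖ ≤ r} ∩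
      ({ω | ∀ ij : Fin p × Fin p, ω ∈ {ω | ∀ k < K N,
          |shardMean (fun z => hess (fun η => ℒ η z) θ₀ ij.1 ij.2) w Z N k ω -
            ∫ z, hess (fun η => ℒ η z) θ₀ ij.1 ij.2 ∂(μ k)| < ε₁}} ∩
       {ω | ∀ a : Fin p × Fin p × Fin p, ω ∈ {ω | ∀ k < K N,
          |shardMean (M a.1 a.2.1 a.2.2) w Z N k ω - ∫ z, M a.1 a.2.1 a.2.2 z ∂(μ k)| < 1}})) := by
    refine ((ProbTendstoOne.of_ae hhat.forall_ae).inter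
      (ProbTendstoOne.of_ae (hC5.forall_ae hS hd))).inter
      ((probTendstoOne_local_consistent hC1 hC3 hhat hr).inter
        (ProbTendstoOne.inter (ProbTendstoOne.forall fun ij => ?_)
          (ProbTendstoOne.forall fun a => ?_)))
    · exact probTendstoOne_shardMean hS hd hrate (hasMomentBounds_hess hC4 hK _ _) hε₁
    · exact probTendstoOne_shardMean hS hd hrate (hasMomentBounds_third hC5 hK _ _ _) one_pos
  refine ⟨c / 2, D, by positivity, fun ε hε => ?_⟩
  -- One third of `ε` goes to the good event, one to the score sums and one to the remainders; the
  -- latter two are divided among the `p` coordinates.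
  have hε3 : 0 < ε / 3 := ENNReal.div_pos hε.ne' (by norm_num)
  have hεp : 0 < ε / 3 / p := ENNReal.div_pos hε3.ne' (ENNReal.natCast_ne_top p)
  have hsum := fun j : Fin p => exists_measure_sum_gt_le hS hd
    (fun N k hk => memLp_score hC3 hC4 hk j) (fun N k hk => hC3.score_mean N k hk j)
    (fun N k hk => integral_score_sq_le hC4 hk (hconst N k hk).2.1 j) hεp
  have hsq := fun j : Fin p => exists_measure_sum_card_mul_shardMean_sq_gt_le hS hrate
    (fun N k hk => memLp_score hC3 hC4 hk j) (fun N k hk => hC3.score_mean N k hk j)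
    (fun N k hk => integral_score_sq_le hC4 hk (hconst N k hk).2.1 j) hC₀ hεp
  choose T hT0 hT using hsum
  choose V hV0 hV using hsq
  have hTsum : ∀ j, T j ≤ ∑ j, T j := fun j =>
    Finset.single_le_sum (fun j _ => (hT0 j).le) (Finset.mem_univ j)
  have hVsum : ∀ j, V j ≤ ∑ j, V j := fun j =>
    Finset.single_le_sum (fun j _ => (hV0 j).le) (Finset.mem_univ j)
  have hTs0 : 0 ≤ ∑ j, T j := Finset.sum_nonneg fun j _ => (hT0 j).le
  have hVs0 : 0 ≤ ∑ j, V j := Finset.sum_nonneg fun j _ => (hV0 j).le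
  refine ⟨∑ j, T j + E * (p * ∑ j, V j), by positivity, ?_⟩
  filter_upwards [eventually_all.2 hT, eventually_all.2 hV, eventually_gt_atTop 0,
    hgood.eventually_le_const hε3] with N hTN hVN hN hgN
  have hNpos : (0 : ℝ) < N := by exact_mod_cast hN
  have hsqrt : 0 < √(N : ℝ) := Real.sqrt_pos.2 hNpos
  have hunion : ∀ A : Fin p → Set Ω, (∀ j, P (A j) ≤ ε / 3 / p) → P (⋃ j, A j) ≤ ε / 3 := by
    intro A hA
    calc P (⋃ j, A j) ≤ ∑ j, P (A j) := measure_iUnion_fintype_le _ _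
      _ ≤ ∑ _j : Fin p, ε / 3 / p := Finset.sum_le_sum fun j _ => hA j
      _ = p * (ε / 3 / p) := by simp
      _ ≤ ε / 3 := ENNReal.mul_div_le
  refine le_trans ((measure_mono ?_).trans (measure_union_le _ _)) ((add_le_add hgN
    ((measure_union_le _ _).trans (add_le_add (hunion _ hTN) (hunion _ hVN)))).trans_eq
      (by rw [← add_assoc, ENNReal.add_thirds]))
  intro ω hω
  by_contra hcon
  refine hω ?_
  rw [Set.mem_union, Set.mem_union, not_or, not_or, Set.mem_compl_iff, not_not] at hcon
  obtain ⟨⟨⟨hmin, hthird⟩, hcons, hhess, hM⟩, hTω, hVω⟩ := hcon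
  simp only [Set.mem_iUnion, Set.mem_ofPred_eq, not_exists, not_le] at hTω hVω
  have hloc := fun k (hk : k < K N) => local_expansion (w := w) (ω := ω) (k := k) hℒ hrδ hball
    hthird (C := C) (c := c) (ε := ε₁) (I := info (μ k) ℒ θ₀)
    (fun a b d => by
      have h1 := (abs_lt.1 (hM (a, b, d) k hk)).2
      have h2 := (hconst N k hk).2.2 a b d
      simp only at h1
      linarith) hC.le hc (hconst N k hk).1
    (fun i j => (hhess (i, j) k hk).le) hsmall (hcons k hk) (hmin k hk).2
  have hexp := hasQuadExpansion_dlsaLoss (θ₀ := θ₀) (Z := Z) (ω := ω) hℒ hd hN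
    (thetaHat := thetaHat) (c := c / 2) (D := D) (E := E) (T := (∑ j, T j) * √(N : ℝ))
    (V := (∑ j, V j) * √(N : ℝ)) hE (fun k hk => hball _ (hcons k hk))
    (fun k hk => (hloc k hk).1)
    (fun k hk i j => by
      have h1 := (hloc k hk).2.1 i j
      have h2 := (hconst N k hk).2.1 i j
      have h3 := abs_sub_abs_le_abs_sub
        (hess (localLoss ℒ w Z N k ω) (thetaHat N k ω) i j) (info (μ k) ℒ θ₀ i j)
      linarith)
    (fun k hk => (hloc k hk).2.2)
    (fun i => (hTω i).le.trans (mul_le_mul_of_nonneg_right (hTsum i) hsqrt.le))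
    (fun i => (hVω i).le.trans (mul_le_mul_of_nonneg_right (hVsum i) hsqrt.le))
  have hB : (∑ j, T j + E * (p * ∑ j, V j)) / √(N : ℝ) =
      (N : ℝ)⁻¹ * ((∑ j, T j) * √(N : ℝ) + E * (p * ((∑ j, V j) * √(N : ℝ)))) := by
    rw [show (N : ℝ)⁻¹ = (√(N : ℝ))⁻¹ * (√(N : ℝ))⁻¹ by
      rw [← mul_inv, Real.mul_self_sqrt hNpos.le]]
    field_simp
  rw [Set.mem_ofPred_eq, hB]
  exact hexp

end DLSA

namespace DLSA

variable {p d₀ : ℕ} {Ω 𝒵 : Type*} {θ₀ θ : Par p} {q : Par p → ℝ} {c D B a : ℝ} {l : Fin p → ℝ}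

/-! ### The penalized estimator -/

lemma le_aLam (l : Fin p → ℝ) {j : Fin p} (hj : (j : ℕ) < d₀) : l j ≤ aLam d₀ l :=
  le_ciSup (f := fun j : {j : Fin p // (j : ℕ) < d₀} => l j) (Set.finite_range _).bddAbove ⟨j, hj⟩

lemma aLam_nonneg (hl : ∀ j, 0 ≤ l j) : 0 ≤ aLam d₀ l :=
  Real.iSup_nonneg fun j => hl j

lemma bLam_le (l : Fin p → ℝ) {j : Fin p} (hj : d₀ ≤ (j : ℕ)) : bLam d₀ l ≤ l j :=
  ciInf_le (f := fun j : {j : Fin p // d₀ ≤ (j : ℕ)} => l j) (Set.finite_range _).bddBelow ⟨j, hj⟩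

/-- The error of a penalized minimizer, when the unpenalized loss has a quadratic expansion. -/
lemma HasQuadExpansion.norm_sub_le (h : HasQuadExpansion q θ₀ c D B) (hB : 0 ≤ B)
    (hθ₀ : ∀ j : Fin p, θ₀ j ≠ 0 ↔ (j : ℕ) < d₀) (hl : ∀ j, 0 ≤ l j) (hla : aLam d₀ l ≤ a)
    (hmin : IsMinOn (fun η => q η + ∑ j, l j * |η j|) Set.univ θ) :
    c * ‖θ - θ₀‖ ≤ 2 * (p * B) + p * a := by
  obtain ⟨q₀, A, b, hq, hA, -, hb⟩ := h
  exact norm_sub_le_of_isMinOn_penalized hq hA hb hB hl ((aLam_nonneg hl).trans hla)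
    (fun j hj => (le_aLam l ((hθ₀ j).1 hj)).trans hla) hmin

lemma HasQuadExpansion.exists_isMinOn (h : HasQuadExpansion q θ₀ c D B) (hc : 0 < c)
    (hl : ∀ j, 0 ≤ l j) : ∃ θ, IsMinOn (fun η => q η + ∑ j, l j * |η j|) Set.univ θ := by
  obtain ⟨q₀, A, b, hq, hA, -, hb⟩ := h
  exact exists_isMinOn_penalized hq hc hA hb hl

lemma HasQuadExpansion.penalty_le (h : HasQuadExpansion q θ₀ c D B)
    (hmin : IsMinOn (fun η => q η + ∑ j, l j * |η j|) Set.univ θ) {j : Fin p}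
    (hj₀ : θ₀ j = 0) (hj : θ j ≠ 0) : l j ≤ (2 * p + 1) * D * ‖θ - θ₀‖ + 2 * B := by
  obtain ⟨q₀, A, b, hq, -, hA, hb⟩ := h
  exact penalty_le_of_ne_zero hq hA hb hmin hj₀ hj

lemma HasQuadExpansion.nonneg_upper (h : HasQuadExpansion q θ₀ c D B) (j : Fin p) : 0 ≤ D := by
  obtain ⟨q₀, A, b, -, -, hA, -⟩ := h
  exact (abs_nonneg _).trans (hA j j)

end DLSA

theorem theorem2 {Ω 𝒵 : Type*} [MeasurableSpace Ω] [MeasurableSpace 𝒵]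
    (P : Measure Ω) [IsProbabilityMeasure P]
    (μ : ℕ → Measure 𝒵) [∀ k, IsProbabilityMeasure (μ k)]
    (p d₀ : ℕ) (hd₀ : 0 < d₀) (hd₀p : d₀ < p)
    -- parameter space, true value, loss
    (Θ : Set (DLSA.Par p)) (θ₀ : DLSA.Par p) (ℒ : DLSA.Par p → 𝒵 → ℝ)
    (hθ₀ : ∀ j : Fin p, θ₀ j ≠ 0 ↔ (j : ℕ) < d₀)
    (hℒ : ∀ z, DLSA.TwiceDifferentiableOn (fun θ => ℒ θ z) (interior Θ))
    -- distributed design and data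
    (K : ℕ → ℕ) (w : ℕ → ℕ → ℕ) (Z : ℕ → ℕ → Ω → 𝒵)
    (hdesign : DLSA.IsBalancedDesign K w)
    (hrate : Tendsto (fun N : ℕ => ((N : ℝ) / K N) / √(N : ℝ)) atTop atTop)
    -- conditions (C1)-(C5)
    (δ : ℝ) (M : Fin p → Fin p → Fin p → 𝒵 → ℝ)
    (hC1 : DLSA.CondC1 Θ θ₀)
    (hC2 : DLSA.IsSample P μ w Z)
    (hC3 : DLSA.CondC3 P μ Θ θ₀ ℒ K w Z)
    (hC4 : DLSA.CondC4 μ θ₀ ℒ K)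
    (hC5 : DLSA.CondC5 μ Θ θ₀ ℒ K δ M)
    (hK : (∃ B : ℕ, ∀ N, K N ≤ B) ∨ DLSA.UniformOverWorkers μ θ₀ ℒ K M)
    -- local estimators, tuning parameters, adaptive Lasso estimator
    (thetaHat : ℕ → ℕ → Ω → DLSA.Par p)
    (hhat : DLSA.IsLocalEstimator P Θ ℒ K w Z thetaHat)
    (lam : ℕ → Ω → Fin p → ℝ) (hlam : ∀ N ω j, 0 ≤ lam N ω j)
    (thetaLam : ℕ → Ω → DLSA.Par p)
    (hthetaLam : DLSA.IsLassoEstimator P ℒ K w Z thetaHat lam thetaLam) :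
    -- (a)
    (TendstoInMeasure P (fun (N : ℕ) ω => √(N : ℝ) * DLSA.aLam d₀ (lam N ω)) atTop (fun _ => 0) →
      DLSA.IsBigOInProb P (fun N ω => thetaLam N ω - θ₀) (fun N => (√(N : ℝ))⁻¹)) ∧
    -- (b)
    (TendstoInMeasure P (fun (N : ℕ) ω => √(N : ℝ) * DLSA.aLam d₀ (lam N ω)) atTop (fun _ => 0) →
      DLSA.TendstoInProbAtTop P (fun N ω => √(N : ℝ) * DLSA.bLam d₀ (lam N ω)) →
      DLSA.ProbTendstoOne P fun N => {ω | ∀ j : Fin p, d₀ ≤ (j : ℕ) → thetaLam N ω j = 0}) := by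
  obtain ⟨c, D, hc, hexp⟩ := DLSA.exists_hasQuadExpansion hℒ hdesign hrate hC1 hC2 hC3 hC4 hC5 hK
    hhat
  -- With high probability the expansion holds and the penalty on the support is negligible.
  have key : TendstoInMeasure P (fun (N : ℕ) ω => √(N : ℝ) * DLSA.aLam d₀ (lam N ω)) atTop
      (fun _ => 0) → ∀ ε : ENNReal, 0 < ε → ∃ B : ℝ, 0 ≤ B ∧ ∀ᶠ N : ℕ in atTop, 0 < N ∧
        P {ω | DLSA.HasQuadExpansion (DLSA.dlsaLoss ℒ K w Z thetaHat N ω) θ₀ c D (B / √(N : ℝ)) ∧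
          IsMinOn (DLSA.lassoObjective ℒ K w Z thetaHat lam N ω) Set.univ (thetaLam N ω) ∧
          c * ‖thetaLam N ω - θ₀‖ ≤ (2 * (p * B) + p) / √(N : ℝ)}ᶜ ≤ ε := by
    intro ha ε hε
    obtain ⟨B, hB, hBN⟩ := hexp (ε / 2) (ENNReal.half_pos hε.ne')
    -- The threshold 1 gives a_λ ≤ 1 / √N, the same order as the linear coefficients B / √N.
    have ha1 := (tendstoInMeasure_iff_norm.1 ha 1 one_pos).eventually_le_const
      (ENNReal.half_pos hε.ne')
    refine ⟨B, hB, ?_⟩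
    filter_upwards [hBN, ha1, eventually_gt_atTop 0] with N h1 h2 hN
    have hsqrt : 0 < √(N : ℝ) := Real.sqrt_pos.2 (by exact_mod_cast hN)
    refine ⟨hN, ?_⟩
    have h3 := ae_iff.1 (hthetaLam N)
    refine le_trans ((measure_mono ?_).trans (measure_union_le _ _)) ((add_le_add
      ((measure_union_le _ _).trans (add_le_add h1 h2)) h3.le).trans_eq
        (by rw [add_zero, ENNReal.add_halves]))
    intro ω hω
    by_contra hcon
    refine hω ?_
    simp only [Set.mem_union, not_or, Set.mem_compl_iff, Set.mem_ofPred_eq, not_not, not_le,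
      sub_zero, Real.norm_eq_abs] at hcon
    obtain ⟨⟨hq, hsmall⟩, hlasso⟩ := hcon
    have hmin := hlasso (hq.exists_isMinOn hc (hlam N ω))
    refine ⟨hq, hmin, ?_⟩
    have hla : DLSA.aLam d₀ (lam N ω) ≤ 1 / √(N : ℝ) := by
      rw [le_div_iff₀ hsqrt, mul_comm]
      exact (le_abs_self _).trans hsmall.le
    refine (hq.norm_sub_le (div_nonneg hB hsqrt.le) hθ₀ (hlam N ω) hla hmin).trans_eq ?_
    ring
  refine ⟨fun ha ε hε => ?_, fun ha hb => ?_⟩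
  · obtain ⟨B, hB, hBN⟩ := key ha ε hε
    refine ⟨(2 * (p * B) + p) / c, ?_⟩
    filter_upwards [hBN] with N hN
    refine (measure_mono fun ω hω => ?_).trans hN.2
    rintro ⟨-, -, hnorm⟩
    rw [Set.mem_ofPred_eq] at hω
    refine absurd hω (not_lt.2 ?_)
    rw [div_mul_eq_mul_div, le_div_iff₀ hc, mul_comm, ← div_eq_mul_inv]
    exact hnorm
  · rw [DLSA.ProbTendstoOne, ENNReal.tendsto_nhds_zero]
    intro ε hε
    obtain ⟨B, hB, hBN⟩ := key ha (ε / 2) (ENNReal.half_pos hε.ne')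
    -- The constant is √N times the largest penalty that a falsely nonzero coordinate can carry,
    -- with the rate just obtained inserted for the error.
    have hbN := (hb ((2 * p + 1) * D * ((2 * (p * B) + p) / c) + 2 * B)).eventually_le_const
      (ENNReal.half_pos hε.ne')
    filter_upwards [hBN, hbN] with N h1 h2
    have hsqrt : 0 < √(N : ℝ) := Real.sqrt_pos.2 (by exact_mod_cast h1.1)
    refine le_trans ((measure_mono ?_).trans (measure_union_le _ _)) ((add_le_add h1.2 h2).trans_eq
      (ENNReal.add_halves ε))
    intro ω hω
    by_contra hcon
    refine hω fun j hj => ?_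
    simp only [Set.mem_union, not_or, Set.mem_compl_iff, Set.mem_ofPred_eq, not_not] at hcon
    obtain ⟨⟨hq, hmin, hnorm⟩, hbig⟩ := hcon
    by_contra hne
    have hj₀ : θ₀ j = 0 := by
      by_contra h
      exact absurd ((hθ₀ j).1 h) (not_lt.2 hj)
    have h3 := (DLSA.bLam_le (lam N ω) hj).trans (hq.penalty_le hmin hj₀ hne)
    have hD := hq.nonneg_upper j
    have h4 : ‖thetaLam N ω - θ₀‖ ≤ (2 * (p * B) + p) / c / √(N : ℝ) := by
      rw [div_right_comm, le_div_iff₀ hc, mul_comm]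
      exact hnorm
    have h5 : (2 * p + 1) * D * ‖thetaLam N ω - θ₀‖ ≤
        (2 * p + 1) * D * ((2 * (p * B) + p) / c / √(N : ℝ)) := by gcongr
    refine absurd hbig (not_lt.2 ?_)
    calc √(N : ℝ) * DLSA.bLam d₀ (lam N ω)
        ≤ √(N : ℝ) * ((2 * p + 1) * D * ((2 * (p * B) + p) / c / √(N : ℝ)) +
          2 * (B / √(N : ℝ))) := mul_le_mul_of_nonneg_left (by linarith) hsqrt.le
      _ = _ := by field_simp
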